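/- Let $d\ge 2$, and let $\mathcal T_d$ be the $d$-regular rooted tree, whose vertices are the finite words over an alphabet $X$ with $d$ letters. For $g\in\mathrm{Aut}(\mathcal T_d)$ and a vertex $v$, the section $g_v\in\mathrm{Aut}(\mathcal T_d)$ is defined by $g(vw)=g(v)g_v(w)$; a subgroup $H\le\mathrm{Aut}(\mathcal T_d)$ is self-similar if it contains all sections of its elements. A self-similar group $H$ is regular branch over a finite index subgroup $K\le H$ if, $\psi:\mathrm{Aut}(\mathcal T_d)\to\mathrm{Aut}(\mathcal T_d)\wr\mathrm{Sym}(d)$ being the wreath recursion, $\psi(K)$ contains $K\times\cdots\times K$ ($d$ factors) as a subgroup of finite index; $K$ is a congruence subgroup of $H$ if it has finite index in $H$ and contains, for some $n\ge 0$, the pointwise stabilizer in $H$ of the $n$th level of the tree. For self-similar $H$, let $\mathrm{AAut}_H(\mathcal T_d)$ be the group of those homeomorphisms of the boundary $X^{\mathbb N}$ that are induced by a forest isomorphism $\mathcal T_d\setminus T\to\mathcal T_d\setminus T'$, where $T,T'$ are finite subtrees that contain the root and all its children and in which every vertex that is not a leaf has all its $d$ children, and which is given by an element of $H$ on each connected component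 (the components being the subtrees hanging below the leaves, naturally identified with $\mathcal T_d$). For a group $\Gamma$ with a commensurated subgroup $\Lambda$, the Schlichting completion $\Gamma/\!\!/\Lambda$ is the closure of the image of $\Gamma$ in $\mathrm{Sym}(\Gamma/\Lambda)$ for the topology of pointwise convergence. Theorem. Let $H\le\mathrm{Aut}(\mathcal T_d)$ be a regular branch group, branching over a congruence subgroup $K$ of $H$, and let $G$ be the closure of $H$ in $\mathrm{Aut}(\mathcal T_d)$ (with the topology of pointwise convergence on vertices). Then $H$ is commensurated in $\mathrm{AAut}_H(\mathcal T_d)$, there is exactly one group topology on $\mathrm{AAut}_G(\mathcal T_d)$ that turns $G$, with its topology inherited from $\mathrm{Aut}(\mathcal T_d)$, into a compact open subgroup, and for this topology the inclusion of $\mathrm{AAut}_H(\mathcal T_d)$ in $\mathrm{AAut}_G(\mathcal T_d)$ induces an isomorphism of topological groups from $\mathrm{AAut}_H(\mathcal T_d)/\!\!/H$ onto $\mathrm{AAut}_G(\mathcal T_d)$. The same conclusion holds when $d=2$ and $H$ is the first Grigorchuk group, generated by $a$, which exchanges the two subtrees below the root, and by $b=(a,c)$, $c=(a,\delta)$, $\delta=(1,b)$: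 the Barnea–Ershov–Weigel group $\mathrm{AAut}_G(\mathcal T_2)$, with $G$ the closure of $H$, is the Schlichting completion of Röver's group $\mathrm{AAut}_H(\mathcal T_2)$ with respect to $H$. -/

import Mathlib

open Topology

namespace TreeAA

/-! ### The regular rooted tree and its automorphism group -/

/-- The rooted tree `T_d`: its vertices are the finite words over the alphabet `Fin d`, the root is
the empty word, and two vertices are adjacent if they are of the form `v` and `vx`. -/
def regularTree (d : ℕ) : SimpleGraph (List (Fin d)) where
  Adj v w := (∃ x, w = v ++ [x]) ∨ (∃ x, v = w ++ [x])
  symm := ⟨fun _ _ h => h.symm⟩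
  loopless := ⟨fun v h => by
    rcases h with ⟨x, h⟩ | ⟨x, h⟩ <;> simpa using congrArg List.length h⟩

/-- `Aut(T_d)`: bijections of the vertex set that fix the root and preserve the edges. -/
def treeAut (d : ℕ) : Subgroup (Equiv.Perm (List (Fin d))) where
  carrier := {g | g [] = [] ∧ ∀ v w, (regularTree d).Adj (g v) (g w) ↔ (regularTree d).Adj v w}
  one_mem' := ⟨rfl, fun _ _ => Iff.rfl⟩
  mul_mem' := by
    rintro a b ⟨ha, ha'⟩ ⟨hb, hb'⟩
    refine ⟨?_, fun v w => ?_⟩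
    · rw [Equiv.Perm.mul_apply, hb, ha]
    · rw [Equiv.Perm.mul_apply, Equiv.Perm.mul_apply, ha', hb']
  inv_mem' := by
    rintro a ⟨ha, ha'⟩
    refine ⟨?_, fun v w => ?_⟩
    · rw [Equiv.Perm.inv_eq_iff_eq, ha]
    · rw [← ha']; simp

/-- The group `Aut(T_d)`, as a type. -/
abbrev TreeAut (d : ℕ) : Type := treeAut d

variable {d : ℕ}

theorem TreeAut.map_nil (g : TreeAut d) : g.1 [] = [] := g.2.1

theorem TreeAut.map_concat (g : TreeAut d) (v : List (Fin d)) (x : Fin d) :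
    ∃ y, g.1 (v ++ [x]) = g.1 v ++ [y] := by
  induction v using List.reverseRecOn generalizing x with
  | nil =>
    rcases (g.2.2 [] ([] ++ [x])).2 (Or.inl ⟨x, rfl⟩) with h | ⟨y, h⟩
    · exact h
    · rw [g.map_nil] at h; simp at h
  | append_singleton u z ih =>
    rcases (g.2.2 (u ++ [z]) (u ++ [z] ++ [x])).2 (Or.inl ⟨x, rfl⟩) with h | ⟨y, h⟩
    · exact h
    · obtain ⟨z', hz⟩ := ih z
      rw [hz] at h
      have h1 := g.1.injective (List.append_inj_left' h rfl)
      simpa using congrArg List.length h1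

theorem TreeAut.length_map (g : TreeAut d) (v : List (Fin d)) : (g.1 v).length = v.length := by
  induction v using List.reverseRecOn with
  | nil => rw [g.map_nil]
  | append_singleton u z ih =>
    obtain ⟨y, hy⟩ := g.map_concat u z
    rw [hy]; simp [ih]

theorem TreeAut.map_append (g : TreeAut d) (v w : List (Fin d)) :
    g.1 (v ++ w) = g.1 v ++ (g.1 (v ++ w)).drop v.length := by
  induction w using List.reverseRecOn with
  | nil => simp [← g.length_map v]
  | append_singleton u z ih =>
    obtain ⟨y, hy⟩ := g.map_concat (v ++ u) z
    rw [← List.append_assoc, hy, List.drop_append_of_le_length (by simp [g.length_map]),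
      ← List.append_assoc, ← ih]

/-- The permutation of the vertices induced by the section `g_v`. -/
def sectionPerm (g : TreeAut d) (v : List (Fin d)) : Equiv.Perm (List (Fin d)) where
  toFun w := (g.1 (v ++ w)).drop v.length
  invFun w := (g⁻¹.1 (g.1 v ++ w)).drop v.length
  left_inv w := by
    have h := g.map_append v w
    change (g⁻¹.1 (g.1 v ++ (g.1 (v ++ w)).drop v.length)).drop v.length = w
    rw [← h]
    simp
  right_inv w := by
    have h := (g⁻¹).map_append (g.1 v) w
    rw [g.length_map] at h
    change (g.1 (v ++ (g⁻¹.1 (g.1 v ++ w)).drop v.length)).drop v.length = w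
    have h2 : g⁻¹.1 (g.1 v) = v := by simp
    rw [h2] at h
    rw [← h]
    simp [← g.length_map v]

theorem sectionPerm_spec (g : TreeAut d) (v w : List (Fin d)) :
    g.1 (v ++ w) = g.1 v ++ sectionPerm g v w := g.map_append v w

/-- The section `g_v` of `g` at the vertex `v`. -/
def treeSection (g : TreeAut d) (v : List (Fin d)) : TreeAut d :=
  ⟨sectionPerm g v, by
    have key : ∀ a b : List (Fin d),
        (regularTree d).Adj (v ++ a) (v ++ b) ↔ (regularTree d).Adj a b := by
      intro a b
      simp [regularTree]
    refine ⟨?_, fun a b => ?_⟩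
    · have := sectionPerm_spec g v []
      simpa using this
    · have h := g.2.2 (v ++ a) (v ++ b)
      rw [key, sectionPerm_spec, sectionPerm_spec] at h
      rw [← h]
      simp [regularTree]⟩

/-- The defining formula `g(vw) = g(v) g_v(w)` of the section. -/
theorem treeSection_spec (g : TreeAut d) (v w : List (Fin d)) :
    g.1 (v ++ w) = g.1 v ++ (treeSection g v).1 w := g.map_append v w

theorem treeSection_unique (g s : TreeAut d) (v : List (Fin d))
    (h : ∀ w, g.1 (v ++ w) = g.1 v ++ s.1 w) : treeSection g v = s := by
  apply Subtype.ext
  apply Equiv.ext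
  intro w
  have := h w
  rw [treeSection_spec] at this
  exact List.append_cancel_left this

/-! ### The topology of pointwise convergence -/

/-- The topology of pointwise convergence on `Sym(X)`, where `X` is a discrete set. -/
instance permTopology (X : Type*) : TopologicalSpace (Equiv.Perm X) :=
  TopologicalSpace.induced (fun (σ : Equiv.Perm X) (x : X) => σ x)
    (@Pi.topologicalSpace X (fun _ => X) (fun _ => ⊥))

theorem isOpen_perm_apply {X : Type*} (x y : X) : IsOpen {σ : Equiv.Perm X | σ x = y} := by
  let _ : TopologicalSpace X := ⊥
  have : DiscreteTopology X := ⟨rfl⟩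
  have hc : Continuous (fun (σ : Equiv.Perm X) (x : X) => σ x) := continuous_induced_dom
  exact (isOpen_discrete ({y} : Set X)).preimage ((continuous_apply x).comp hc)

theorem continuous_perm {X Y : Type*} [TopologicalSpace Y] (f : Y → Equiv.Perm X)
    (h : ∀ x y, IsOpen {t | f t x = y}) : Continuous f := by
  let _ : TopologicalSpace X := ⊥
  have : DiscreteTopology X := ⟨rfl⟩
  refine continuous_induced_rng.2 (continuous_pi fun x => ?_)
  exact continuous_discrete_rng.2 fun y => h x y

instance perm_isTopologicalGroup (X : Type*) : IsTopologicalGroup (Equiv.Perm X) where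
  continuous_mul := by
    refine continuous_perm _ fun x y => ?_
    have : {t : Equiv.Perm X × Equiv.Perm X | (t.1 * t.2) x = y} =
        ⋃ z, {σ : Equiv.Perm X | σ z = y} ×ˢ {σ : Equiv.Perm X | σ x = z} := by
      ext t; simp
    rw [this]
    exact isOpen_iUnion fun z => (isOpen_perm_apply z y).prod (isOpen_perm_apply x z)
  continuous_inv := by
    refine continuous_perm _ fun x y => ?_
    have : {t : Equiv.Perm X | t⁻¹ x = y} = {σ : Equiv.Perm X | σ y = x} := by
      ext t
      rw [Set.mem_ofPred_eq, Set.mem_ofPred_eq, Equiv.Perm.inv_eq_iff_eq, eq_comm]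
    rw [this]
    exact isOpen_perm_apply y x

/-! ### Self-similar groups, congruence subgroups, regular branch groups -/

/-- `G` is self-similar if every section of every element of `G` belongs to `G`. -/
def IsSelfSimilar (G : Subgroup (TreeAut d)) : Prop :=
  ∀ g ∈ G, ∀ v : List (Fin d), treeSection g v ∈ G

theorem continuous_treeSection (v : List (Fin d)) :
    Continuous (fun g : TreeAut d => treeSection g v) := by
  refine Continuous.subtype_mk (continuous_perm _ fun x y => ?_) _
  have : {g : TreeAut d | sectionPerm g v x = y} =
      Subtype.val ⁻¹' (⋃ z ∈ {z : List (Fin d) | z.drop v.length = y},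
        {σ : Equiv.Perm (List (Fin d)) | σ (v ++ x) = z}) := by
    ext g; simp [sectionPerm]
  rw [this]
  exact (isOpen_biUnion fun z _ => isOpen_perm_apply _ z).preimage continuous_subtype_val

/-- The closure in `Aut(T_d)` of a self-similar group is self-similar. -/
theorem IsSelfSimilar.topologicalClosure {G : Subgroup (TreeAut d)} (hG : IsSelfSimilar G) :
    IsSelfSimilar G.topologicalClosure := fun _ hg v =>
  map_mem_closure (f := fun g : TreeAut d => treeSection g v) (continuous_treeSection v) hg
    fun a ha => hG a ha v

/-- The automorphisms that fix every vertex of level `n`. -/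
def levelStabilizer (d n : ℕ) : Subgroup (TreeAut d) where
  carrier := {g | ∀ v : List (Fin d), v.length = n → g.1 v = v}
  one_mem' := fun _ _ => rfl
  mul_mem' := fun {a b} ha hb v hv => by
    change a.1 (b.1 v) = v
    rw [hb v hv, ha v hv]
  inv_mem' := fun {a} ha v hv => by
    change a.1⁻¹ v = v
    rw [Equiv.Perm.inv_eq_iff_eq, ha v hv]

/-- `K` is a congruence subgroup of `G`: a finite index subgroup of `G` that contains some level
stabilizer `G_n` of `G`. -/
structure IsCongruenceSubgroup (G K : Subgroup (TreeAut d)) : Prop where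
  le : K ≤ G
  finiteIndex : K.IsFiniteRelIndex G
  contains_levelStabilizer : ∃ n, G ⊓ levelStabilizer d n ≤ K

/-- The subgroup `ψ⁻¹(K × ⋯ × K)` of `Aut(T_d)`, where
`ψ : Aut(T_d) → Aut(T_d) ≀ Sym(d)` is the wreath recursion: the automorphisms that fix the
first level and all of whose sections at the vertices of level one are in `K`. -/
def levelOneProduct (K : Subgroup (TreeAut d)) : Subgroup (TreeAut d) where
  carrier := {g | ∀ x : Fin d, g.1 [x] = [x] ∧ treeSection g [x] ∈ K}
  one_mem' := fun x => ⟨rfl, by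
    rw [treeSection_unique 1 1 [x] fun _ => rfl]; exact K.one_mem⟩
  mul_mem' := fun {a b} ha hb x => by
    have h1 : (a * b).1 [x] = [x] := by
      change a.1 (b.1 [x]) = [x]
      rw [(hb x).1, (ha x).1]
    refine ⟨h1, ?_⟩
    rw [treeSection_unique (a * b) (treeSection a [x] * treeSection b [x]) [x] fun w => ?_]
    · exact K.mul_mem (ha x).2 (hb x).2
    · rw [h1]
      change a.1 (b.1 ([x] ++ w)) = [x] ++ (treeSection a [x]).1 ((treeSection b [x]).1 w)
      rw [treeSection_spec b, (hb x).1, treeSection_spec a, (ha x).1]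
  inv_mem' := fun {a} ha x => by
    have h1 : a⁻¹.1 [x] = [x] := by
      change a.1⁻¹ [x] = [x]
      rw [Equiv.Perm.inv_eq_iff_eq, (ha x).1]
    refine ⟨h1, ?_⟩
    rw [treeSection_unique a⁻¹ (treeSection a [x])⁻¹ [x] fun w => ?_]
    · exact K.inv_mem (ha x).2
    · rw [h1]
      change a.1⁻¹ ([x] ++ w) = [x] ++ (treeSection a [x]).1⁻¹ w
      rw [Equiv.Perm.inv_eq_iff_eq, treeSection_spec a, (ha x).1]
      simp

/-- `G` is self-similar, and regular branch over its finite index subgroup `K`: the group `ψ(K)`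
contains `K × ⋯ × K` as a subgroup of finite index. -/
structure IsRegularBranchOver (G K : Subgroup (TreeAut d)) : Prop where
  selfSimilar : IsSelfSimilar G
  le : K ≤ G
  finiteIndex : K.IsFiniteRelIndex G
  product_le : levelOneProduct K ≤ K
  product_finiteIndex : (levelOneProduct K).IsFiniteRelIndex K

/-! ### The boundary of the tree -/

/-- The boundary of `T_d`: infinite words, with the product topology of the discrete topologies. -/
abbrev Boundary (d : ℕ) : Type := ℕ → Fin d

/-- The prefix of length `n` of the infinite word `ξ`. -/
def pref (ξ : Boundary d) (n : ℕ) : List (Fin d) := List.ofFn fun i : Fin n => ξ i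

/-- The ray `ξ` passes through the vertex `v`, that is, `v` is a prefix of `ξ`. -/
def Through (ξ : Boundary d) (v : List (Fin d)) : Prop := pref ξ v.length = v

@[simp] theorem length_pref (ξ : Boundary d) (n : ℕ) : (pref ξ n).length = n := by simp [pref]

theorem through_pref (ξ : Boundary d) (n : ℕ) : Through ξ (pref ξ n) := by simp [Through]

theorem pref_succ (ξ : Boundary d) (n : ℕ) : pref ξ (n + 1) = pref ξ n ++ [ξ n] := by
  unfold pref
  rw [List.ofFn_succ_last]
  simp

theorem pref_add (ξ : Boundary d) (m n : ℕ) :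
    pref ξ (m + n) = pref ξ m ++ pref (fun k => ξ (m + k)) n := by
  induction n with
  | zero => simp [pref]
  | succ n ih => rw [← Nat.add_assoc, pref_succ, ih, pref_succ, List.append_assoc]

theorem ext_pref {ξ η : Boundary d} (h : ∀ n, pref ξ n = pref η n) : ξ = η := by
  funext n
  have := h (n + 1)
  rw [pref_succ, pref_succ] at this
  simpa using List.append_inj_right' this rfl

theorem Through.of_append {ξ : Boundary d} {v w : List (Fin d)} (h : Through ξ (v ++ w)) :
    Through ξ v := by
  unfold Through at *
  rw [List.length_append, pref_add] at h
  exact List.append_inj_left h (by simp)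

theorem Through.of_prefix {ξ : Boundary d} {v w : List (Fin d)} (h : Through ξ w)
    (hv : v <+: w) : Through ξ v := by
  obtain ⟨t, rfl⟩ := hv
  exact h.of_append

theorem Through.prefix_of_le {ξ : Boundary d} {v w : List (Fin d)} (hv : Through ξ v)
    (hw : Through ξ w) (h : v.length ≤ w.length) : v <+: w := by
  obtain ⟨k, hk⟩ := Nat.exists_eq_add_of_le h
  unfold Through at *
  rw [hk, pref_add, hv] at hw
  exact ⟨_, hw⟩

theorem exists_through [NeZero d] (v : List (Fin d)) : ∃ ξ : Boundary d, Through ξ v := by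
  refine ⟨fun n => v.getD n 0, ?_⟩
  unfold Through pref
  apply List.ext_getElem <;> simp

/-- The action of a tree automorphism on the boundary. -/
def boundaryMap (g : TreeAut d) (ξ : Boundary d) : Boundary d := fun n =>
  (g.1 (pref ξ (n + 1)))[n]'(by simp [g.length_map])

/-- `boundaryMap g` sends the ray through `v₀, v₁, v₂, …` to the ray through
`g v₀, g v₁, g v₂, …`. -/
theorem pref_boundaryMap (g : TreeAut d) (ξ : Boundary d) (n : ℕ) :
    pref (boundaryMap g ξ) n = g.1 (pref ξ n) := by
  induction n with
  | zero => simp [pref, g.map_nil]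
  | succ n ih =>
    rw [pref_succ, ih]
    obtain ⟨y, hy⟩ := g.map_concat (pref ξ n) (ξ n)
    have hy' : g.1 (pref ξ (n + 1)) = g.1 (pref ξ n) ++ [y] := by rw [pref_succ, hy]
    have : boundaryMap g ξ n = y := by
      unfold boundaryMap
      simp [hy', g.length_map]
    rw [this, hy']

theorem continuous_boundaryMap (g : TreeAut d) : Continuous (boundaryMap g) := by
  refine continuous_pi fun n => ?_
  let F : (Fin (n + 1) → Fin d) → Fin d := fun a =>
    (g.1 (List.ofFn a))[n]'(by simp [g.length_map])
  have hF : Continuous F := continuous_of_discreteTopology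
  exact hF.comp (continuous_pi fun i : Fin (n + 1) => continuous_apply (i : ℕ))

/-- The homomorphism from `Aut(T_d)` to the homeomorphism group of the boundary. -/
def boundaryHom (d : ℕ) : TreeAut d →* (Boundary d ≃ₜ Boundary d) where
  toFun g :=
    { toFun := boundaryMap g
      invFun := boundaryMap g⁻¹
      left_inv := fun ξ => ext_pref fun n => by simp [pref_boundaryMap]
      right_inv := fun ξ => ext_pref fun n => by simp [pref_boundaryMap]
      continuous_toFun := continuous_boundaryMap g
      continuous_invFun := continuous_boundaryMap g⁻¹ }
  map_one' := Homeomorph.ext fun ξ => ext_pref fun n => by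
    change pref (boundaryMap 1 ξ) n = pref ξ n
    simp [pref_boundaryMap]
  map_mul' g h := Homeomorph.ext fun ξ => ext_pref fun n => by
    change pref (boundaryMap (g * h) ξ) n = pref (boundaryMap g (boundaryMap h ξ)) n
    simp [pref_boundaryMap]

/-! ### Almost automorphisms -/

/-- A finite rooted complete subtree of `T_d`: a finite set of vertices spanning a subtree that
contains the root together with its `d` children, and in which every vertex that is not a leaf
has all its `d` children. -/
structure CompleteSubtree (d : ℕ) where
  verts : Set (List (Fin d))
  finite : verts.Finite
  root_mem : [] ∈ verts
  root_children : ∀ x, [x] ∈ verts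
  parent_mem : ∀ v x, v ++ [x] ∈ verts → v ∈ verts
  children_mem : ∀ v x y, v ++ [x] ∈ verts → v ++ [y] ∈ verts

/-- The leaves of a finite rooted complete subtree. -/
def CompleteSubtree.leaves (T : CompleteSubtree d) : Set (List (Fin d)) :=
  {v | v ∈ T.verts ∧ ∀ x, v ++ [x] ∉ T.verts}

/-- A forest isomorphism `T_d ∖ T → T_d ∖ T'`. The connected components of `T_d ∖ T` are the
subtrees hanging below the leaves of `T`, each being identified with `T_d` through `vw ↔ w`. The
isomorphism maps the component at the leaf `v` onto the component at the leaf `leafEquiv v`, and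
is there the tree automorphism `label v` after these identifications, that is, it sends the
vertex `vw` to `leafEquiv v ++ label v w`. -/
structure ForestIso (T T' : CompleteSubtree d) where
  leafEquiv : T.leaves ≃ T'.leaves
  label : T.leaves → TreeAut d

/-- On the rays through `v`, the map `φ` is induced by `vw ↦ u g(w)`. -/
def ActsOn (φ : Boundary d ≃ₜ Boundary d) (v u : List (Fin d)) (g : TreeAut d) : Prop :=
  ∀ (w : List (Fin d)) (ξ : Boundary d), Through ξ (v ++ w) → Through (φ ξ) (u ++ g.1 w)

/-- `φ` is the homeomorphism of the boundary induced by the forest isomorphism `ψ`: if a ray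
passes through the vertex `z` of the forest, then its image under `φ` passes through `ψ z`. -/
def ForestIso.Induces {T T' : CompleteSubtree d} (ψ : ForestIso T T')
    (φ : Boundary d ≃ₜ Boundary d) : Prop :=
  ∀ v : T.leaves, ActsOn φ v (ψ.leafEquiv v) (ψ.label v)

/-- `φ` is an almost automorphism of `T_d` that is piecewise of type `G`. -/
def IsPiecewise (G : Subgroup (TreeAut d)) (φ : Boundary d ≃ₜ Boundary d) : Prop :=
  ∃ (T T' : CompleteSubtree d) (ψ : ForestIso T T'), ψ.Induces φ ∧ ∀ v, ψ.label v ∈ G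

/-! The next facts show that the almost automorphisms of type `G` form a group. -/

theorem ActsOn.append {φ : Boundary d ≃ₜ Boundary d} {v u : List (Fin d)} {g : TreeAut d}
    (h : ActsOn φ v u g) (t : List (Fin d)) :
    ActsOn φ (v ++ t) (u ++ g.1 t) (treeSection g t) := by
  intro w ξ hξ
  rw [List.append_assoc] at hξ ⊢
  rw [← treeSection_spec]
  exact h _ _ hξ

theorem ActsOn.mul {φ χ : Boundary d ≃ₜ Boundary d} {v u z : List (Fin d)} {g h : TreeAut d}
    (h1 : ActsOn φ v u g) (h2 : ActsOn χ u z h) : ActsOn (χ * φ) v z (h * g) :=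
  fun w ξ hξ => h2 _ _ (h1 w ξ hξ)

theorem ActsOn.inv {φ : Boundary d ≃ₜ Boundary d} {v u : List (Fin d)} {g : TreeAut d}
    (h : ActsOn φ v u g) : ActsOn φ⁻¹ u v g⁻¹ := by
  intro w ζ hζ
  let ζ' : Boundary d := fun k => ζ (u.length + k)
  have hζu : Through ζ u := hζ.of_append
  have hζn : ∀ n, pref ζ (u.length + n) = u ++ pref ζ' n := fun n => by
    rw [pref_add, hζu]
  let θ : Boundary d := boundaryMap g⁻¹ ζ'
  let η : Boundary d := fun n => if hn : n < v.length then v[n] else θ (n - v.length)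
  have hηv : pref η v.length = v := by
    unfold pref
    apply List.ext_getElem <;> simp [η]
  have hη : ∀ n, pref η (v.length + n) = v ++ pref θ n := fun n => by
    rw [pref_add, hηv]
    simp [η]
  have hφ : φ η = ζ := by
    have key : ∀ n, pref (φ η) (u.length + n) = pref ζ (u.length + n) := fun n => by
      have h1 : Through η (v ++ pref θ n) := by
        unfold Through
        rw [List.length_append, length_pref, hη]
      have h2 := h _ _ h1
      have h3 : g.1 (pref θ n) = pref ζ' n := by
        simp [θ, pref_boundaryMap]
      rw [h3] at h2
      unfold Through at h2
      rw [List.length_append, length_pref] at h2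
      rw [h2, hζn]
    funext n
    have e : pref (φ η) (u.length + n + 1) = pref ζ (u.length + n + 1) := key (n + 1)
    have e2 : pref (φ η) (n + 1 + u.length) = pref ζ (n + 1 + u.length) := by
      have : n + 1 + u.length = u.length + n + 1 := by omega
      rw [this]; exact e
    rw [pref_add (φ η) (n + 1), pref_add ζ (n + 1)] at e2
    have e3 := List.append_inj_left e2 (by simp)
    rw [pref_succ, pref_succ] at e3
    simpa using List.append_inj_right' e3 rfl
  have hφ' : φ⁻¹ ζ = η := by
    rw [← hφ]; exact φ.symm_apply_apply η
  rw [hφ']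
  have hw : pref ζ' w.length = w := by
    have := hζ
    unfold Through at this
    rw [List.length_append, hζn] at this
    exact List.append_cancel_left this
  unfold Through
  rw [List.length_append, hη, TreeAut.length_map, pref_boundaryMap, hw]

/-- At some level `n`, the map `φ` is of type `G` below each vertex of level `n`. -/
def UniformAt (G : Subgroup (TreeAut d)) (φ : Boundary d ≃ₜ Boundary d) (n : ℕ) : Prop :=
  ∀ v : List (Fin d), v.length = n → ∃ u, ∃ g ∈ G, ActsOn φ v u g

theorem UniformAt.add {G : Subgroup (TreeAut d)} (hG : IsSelfSimilar G)
    {φ : Boundary d ≃ₜ Boundary d} {n : ℕ} (h : UniformAt G φ n) (m : ℕ)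
    (v : List (Fin d)) (hv : v.length = n + m) :
    ∃ u, m ≤ u.length ∧ ∃ g ∈ G, ActsOn φ v u g := by
  obtain ⟨u, g, hg, hu⟩ := h (v.take n) (by simp [hv])
  refine ⟨u ++ g.1 (v.drop n), ?_, _, hG g hg (v.drop n), ?_⟩
  · simp [g.length_map, hv]
  · have := hu.append (v.drop n)
    rwa [List.take_append_drop] at this

theorem CompleteSubtree.exists_leaf (T : CompleteSubtree d) (v : List (Fin d)) :
    v ∈ T.verts ∨ ∃ l ∈ T.leaves, l <+: v := by
  induction v using List.reverseRecOn with
  | nil => exact Or.inl T.root_mem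
  | append_singleton u z ih =>
    rcases ih with h | ⟨l, hl, hlu⟩
    · by_cases hu : ∃ x, u ++ [x] ∈ T.verts
      · obtain ⟨x, hx⟩ := hu
        exact Or.inl (T.children_mem u x z hx)
      · push Not at hu
        exact Or.inr ⟨u, ⟨h, hu⟩, List.prefix_append _ _⟩
    · exact Or.inr ⟨l, hl, hlu.trans (List.prefix_append _ _)⟩

theorem IsPiecewise.uniform {G : Subgroup (TreeAut d)} (hG : IsSelfSimilar G)
    {φ : Boundary d ≃ₜ Boundary d} (h : IsPiecewise G φ) : ∃ n, UniformAt G φ n := by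
  obtain ⟨T, T', ψ, hψ, hl⟩ := h
  obtain ⟨N, hN⟩ := (T.finite.image List.length).bddAbove
  refine ⟨N + 1, fun v hv => ?_⟩
  rcases T.exists_leaf v with h | ⟨l, hlT, t, rfl⟩
  · have := hN ⟨v, h, rfl⟩
    omega
  · exact ⟨_, _, hG _ (hl ⟨l, hlT⟩) t, (hψ ⟨l, hlT⟩).append t⟩

/-- The ball of radius `n + 1` around the root. -/
def CompleteSubtree.ball (d n : ℕ) : CompleteSubtree d where
  verts := {v | v.length ≤ n + 1}
  finite := List.finite_length_le (Fin d) (n + 1)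
  root_mem := by simp
  root_children := by simp
  parent_mem v x h := by
    simp only [Set.mem_ofPred_eq, List.length_append, List.length_singleton] at h ⊢
    omega
  children_mem v x y h := by simpa using h

theorem UniformAt.isPiecewise {G : Subgroup (TreeAut d)} (hG : IsSelfSimilar G)
    {φ : Boundary d ≃ₜ Boundary d} {n : ℕ} (h : UniformAt G φ n) : IsPiecewise G φ := by
  rcases Nat.eq_zero_or_pos d with rfl | hd
  · exact ⟨.ball 0 0, .ball 0 0, ⟨Equiv.refl _, fun _ => 1⟩, fun _ _ ξ => (ξ 0).elim0,
      fun _ => G.one_mem⟩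
  have : NeZero d := ⟨hd.ne'⟩
  have h' : ∀ v : List (Fin d), ∃ u, ∃ g : TreeAut d, v.length = n + 1 →
      1 ≤ u.length ∧ g ∈ G ∧ ActsOn φ v u g := fun v => by
    by_cases hv : v.length = n + 1
    · obtain ⟨u, h1, g, h2, h3⟩ := h.add hG 1 v hv
      exact ⟨u, g, fun _ => ⟨h1, h2, h3⟩⟩
    · exact ⟨[], 1, fun h => absurd h hv⟩
  choose u g hug using h'
  have hthr : ∀ v : List (Fin d), v.length = n + 1 → ∀ ζ, Through ζ (u v) →
      Through (φ⁻¹ ζ) v := fun v hv ζ hζ => by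
    have := (hug v hv).2.2.inv [] ζ (by simpa using hζ)
    simpa [TreeAut.map_nil] using this.of_append
  have hcover : ∀ ζ : Boundary d, ∃ v, v.length = n + 1 ∧ Through ζ (u v) := fun ζ => by
    refine ⟨pref (φ⁻¹ ζ) (n + 1), length_pref _ _, ?_⟩
    have := (hug _ (length_pref (φ⁻¹ ζ) (n + 1))).2.2 [] (φ⁻¹ ζ)
      (by simpa using through_pref _ _)
    have e : φ (φ⁻¹ ζ) = ζ := φ.apply_symm_apply ζ
    rw [e] at this
    exact this.of_append
  have hdisj : ∀ v w : List (Fin d), v.length = n + 1 → w.length = n + 1 → u v <+: u w →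
      v = w := fun v w hv hw hvw => by
    obtain ⟨ζ, hζ⟩ := exists_through (u w)
    have h1 := hthr w hw ζ hζ
    have h2 := hthr v hv ζ (hζ.of_prefix hvw)
    unfold Through at h1 h2
    rw [← h1, ← h2, hv, hw]
  have hcomp : ∀ p : List (Fin d), ∃ v, v.length = n + 1 ∧ (p <+: u v ∨
      (u v <+: p ∧ (u v).length < p.length)) := fun p => by
    obtain ⟨ζ, hζ⟩ := exists_through p
    obtain ⟨v, hv, hζv⟩ := hcover ζ
    refine ⟨v, hv, ?_⟩
    rcases Nat.lt_or_ge (u v).length p.length with hl | hl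
    · exact Or.inr ⟨hζv.prefix_of_le hζ hl.le, hl⟩
    · exact Or.inl (hζ.prefix_of_le hζv hl)
  let T' : CompleteSubtree d :=
    { verts := {p | ∃ v : List (Fin d), v.length = n + 1 ∧ p <+: u v}
      finite := by
        have hf : {v : List (Fin d) | v.length = n + 1}.Finite :=
          List.finite_length_eq (Fin d) (n + 1)
        refine (hf.biUnion fun v _ => List.finite_toSet (u v).inits).subset ?_
        rintro p ⟨v, hv, hp⟩
        simp only [Set.mem_iUnion]
        exact ⟨v, hv, (List.mem_inits p (u v)).2 hp⟩
      root_mem := ⟨List.replicate (n + 1) 0, by simp, List.nil_prefix⟩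
      root_children := fun x => by
        obtain ⟨v, hv, h1 | ⟨_, h1⟩⟩ := hcomp [x]
        · exact ⟨v, hv, h1⟩
        · have := (hug v hv).1
          simp at h1
          simp [h1] at this
      parent_mem := by
        rintro v x ⟨w, hw, h1⟩
        exact ⟨w, hw, (List.prefix_append _ _).trans h1⟩
      children_mem := by
        rintro p x y ⟨w, hw, h1⟩
        obtain ⟨v, hv, h2 | ⟨h2, h3⟩⟩ := hcomp (p ++ [y])
        · exact ⟨v, hv, h2⟩
        · have h4 : u v <+: p := List.prefix_of_prefix_length_le h2 (List.prefix_append _ _)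
            (by simp at h3; omega)
          have h5 := hdisj v w hv hw (h4.trans ((List.prefix_append _ _).trans h1))
          subst h5
          have := (h1.trans h4).length_le
          simp at this }
  have hleaf : ∀ v : List (Fin d), v.length = n + 1 → u v ∈ T'.leaves := fun v hv => by
    refine ⟨⟨v, hv, List.prefix_rfl⟩, ?_⟩
    rintro x ⟨w, hw, h1⟩
    have h2 := hdisj v w hv hw ((List.prefix_append _ _).trans h1)
    subst h2
    have := h1.length_le
    simp at this
  have hball : ∀ v : (CompleteSubtree.ball d n).leaves, v.1.length = n + 1 := by
    rintro ⟨v, hv, hv'⟩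
    have h1 : v.length ≤ n + 1 := hv
    have h2 : ¬ (v ++ [(0 : Fin d)]).length ≤ n + 1 := hv' 0
    simp at h2
    change v.length = n + 1
    omega
  let f : (CompleteSubtree.ball d n).leaves → T'.leaves := fun v => ⟨u v.1, hleaf _ (hball v)⟩
  have hf : Function.Bijective f := by
    constructor
    · intro v w hvw
      have : u v.1 = u w.1 := congrArg Subtype.val hvw
      exact Subtype.ext (hdisj _ _ (hball v) (hball w) (by rw [this]))
    · rintro ⟨p, ⟨v, hv, t, ht⟩, hp⟩
      cases t with
      | nil =>
        refine ⟨⟨v, ?_, fun x => ?_⟩, ?_⟩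
        · exact hv.le
        · change ¬ (v ++ [x]).length ≤ n + 1
          simp [hv]
        · apply Subtype.ext
          simpa using ht.symm
      | cons x t =>
        exact absurd ⟨v, hv, t, by simpa using ht⟩ (hp x)
  exact ⟨.ball d n, T', ⟨Equiv.ofBijective f hf, fun v => g v.1⟩,
    fun v => (hug v.1 (hball v)).2.2, fun v => (hug v.1 (hball v)).2.1⟩

/-- The group `AAut_G(T_d)` of almost automorphisms that are piecewise of type `G`, for a
self-similar group `G`, as a subgroup of the homeomorphism group of the boundary. -/
def AAut (G : Subgroup (TreeAut d)) (hG : IsSelfSimilar G) :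
    Subgroup (Boundary d ≃ₜ Boundary d) where
  carrier := {φ | IsPiecewise G φ}
  one_mem' := ⟨.ball d 0, .ball d 0, ⟨Equiv.refl _, fun _ => 1⟩, fun _ _ _ h => h,
    fun _ => G.one_mem⟩
  mul_mem' := by
    intro χ φ hχ hφ
    obtain ⟨m, hm⟩ := hχ.uniform hG
    obtain ⟨n, hn⟩ := hφ.uniform hG
    refine UniformAt.isPiecewise (n := n + m) hG fun v hv => ?_
    obtain ⟨u, hu, g, hg, hvu⟩ := hn.add hG m v hv
    obtain ⟨z, _, h, hh, huz⟩ := hm.add hG (u.length - m) u (by omega)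
    exact ⟨z, h * g, G.mul_mem hh hg, hvu.mul huz⟩
  inv_mem' := by
    rintro φ ⟨T, T', ψ, hψ, hl⟩
    refine ⟨T', T, ⟨ψ.leafEquiv.symm, fun v => (ψ.label (ψ.leafEquiv.symm v))⁻¹⟩, fun v => ?_,
      fun v => G.inv_mem (hl _)⟩
    have := (hψ (ψ.leafEquiv.symm v)).inv
    rwa [Equiv.apply_symm_apply] at this

theorem boundaryHom_mem (G : Subgroup (TreeAut d)) (hG : IsSelfSimilar G) (g : G) :
    boundaryHom d g ∈ AAut G hG := by
  refine UniformAt.isPiecewise (n := 0) hG fun v hv => ⟨[], g, g.2, ?_⟩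
  obtain rfl := List.eq_nil_of_length_eq_zero hv
  intro w ξ hξ
  change pref (boundaryMap g.1 ξ) (g.1.1 w).length = g.1.1 w
  rw [pref_boundaryMap, g.1.length_map]
  exact congrArg _ hξ

/-- The embedding of `G` in `AAut_G(T_d)`. -/
def toAAut (G : Subgroup (TreeAut d)) (hG : IsSelfSimilar G) : G →* AAut G hG :=
  ((boundaryHom d).comp G.subtype).codRestrict (AAut G hG) (boundaryHom_mem G hG)

/-- `τ` is a group topology on `AAut_G(T_d)` that turns `G`, with its topology inherited from
`Aut(T_d)`, into a compact open subgroup. -/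
def IsCompatibleTopology (G : Subgroup (TreeAut d)) (hG : IsSelfSimilar G)
    (τ : TopologicalSpace (AAut G hG)) : Prop :=
  IsTopologicalGroup (AAut G hG) ∧ IsOpenEmbedding (toAAut G hG) ∧
    IsCompact (Set.range (toAAut G hG))

/-! ### Schlichting completions -/

/-- The Schlichting completion of `Γ` with respect to `Λ`: the closure of the image of `Γ` in
`Sym(Γ/Λ)`, with its topology of pointwise convergence. -/
abbrev SchlichtingCompletion (Γ : Type*) [Group Γ] (Λ : Subgroup Γ) : Type _ :=
  (MulAction.toPermHom Γ (Γ ⧸ Λ)).range.topologicalClosure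

/-- The canonical homomorphism from `Γ` to its Schlichting completion. -/
def toSchlichting (Γ : Type*) [Group Γ] (Λ : Subgroup Γ) : Γ →* SchlichtingCompletion Γ Λ :=
  (MulAction.toPermHom Γ (Γ ⧸ Λ)).codRestrict _ fun γ =>
    Subgroup.le_topologicalClosure _ ⟨γ, rfl⟩

/-- The assertion, for a self-similar group `H` with closure `G` in `Aut(T_d)`, that the inclusion
of `AAut_H(T_d)` in `AAut_G(T_d)` induces an isomorphism of topological groups from the
Schlichting completion of `AAut_H(T_d)` with respect to `H` onto `AAut_G(T_d)`. This comprises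
what it presupposes: `H` is commensurated in `AAut_H(T_d)`, and there is exactly one group
topology on `AAut_G(T_d)` that turns `G` into a compact open subgroup. -/
def InclusionInducesIso (H : Subgroup (TreeAut d)) (hH : IsSelfSimilar H) : Prop :=
  Subgroup.Commensurable.commensurator (toAAut H hH).range = ⊤ ∧
  (∃! τ : TopologicalSpace (AAut H.topologicalClosure hH.topologicalClosure),
    IsCompatibleTopology H.topologicalClosure hH.topologicalClosure τ) ∧
  ∀ τ : TopologicalSpace (AAut H.topologicalClosure hH.topologicalClosure),
    IsCompatibleTopology H.topologicalClosure hH.topologicalClosure τ →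
    ∃ Φ : SchlichtingCompletion (AAut H hH) (toAAut H hH).range ≃ₜ*
        AAut H.topologicalClosure hH.topologicalClosure,
      ∀ γ : AAut H hH,
        (Φ (toSchlichting (AAut H hH) (toAAut H hH).range γ) : Boundary d ≃ₜ Boundary d) = γ

/-! ### The Grigorchuk group -/

/-- The generator `a`, which exchanges the two subtrees below the root. -/
def grigA : List (Fin 2) → List (Fin 2)
  | [] => []
  | x :: w => (1 - x) :: w

/-- The generators `b`, `c`, `d`, for the indices `0`, `1`, `2`, given by the wreath recursion
`b = (a, c)`, `c = (a, d)`, `d = (1, b)`. -/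
def grigB : Fin 3 → List (Fin 2) → List (Fin 2)
  | _, [] => []
  | k, x :: w => if x = 0 then 0 :: (if k = 2 then w else grigA w) else 1 :: grigB (k + 1) w

theorem grigA_grigA (w : List (Fin 2)) : grigA (grigA w) = w := by
  cases w <;> simp [grigA]

theorem grigB_grigB (k : Fin 3) (w : List (Fin 2)) : grigB k (grigB k w) = w := by
  induction w generalizing k with
  | nil => simp [grigB]
  | cons x w ih =>
    by_cases hx : x = 0
    · by_cases hk : k = 2 <;> simp [grigB, hx, hk, grigA_grigA]
    · have : x = 1 := by omega
      simp [grigB, this, ih]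

theorem grigA_concat (v : List (Fin 2)) (x : Fin 2) :
    ∃ y, grigA (v ++ [x]) = grigA v ++ [y] := by
  cases v <;> simp [grigA]

theorem grigB_concat (k : Fin 3) (v : List (Fin 2)) (x : Fin 2) :
    ∃ y, grigB k (v ++ [x]) = grigB k v ++ [y] := by
  induction v generalizing k with
  | nil => by_cases hx : x = 0 <;> by_cases hk : k = 2 <;> simp [grigB, hx, hk, grigA]
  | cons z v ih =>
    by_cases hz : z = 0
    · by_cases hk : k = 2
      · simp [grigB, hz, hk]
      · simpa [grigB, hz, hk] using grigA_concat v x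
    · simpa [grigB, hz] using ih (k + 1)

/-- An involution of the set of vertices that fixes the root and sends children to children. -/
def treeAutOfInvolution (f : List (Fin d) → List (Fin d)) (hf : ∀ w, f (f w) = w)
    (h0 : f [] = []) (h1 : ∀ v x, ∃ y, f (v ++ [x]) = f v ++ [y]) : TreeAut d :=
  ⟨⟨f, f, hf, hf⟩, h0, by
    have key : ∀ v w, (regularTree d).Adj v w → (regularTree d).Adj (f v) (f w) := by
      rintro v w (⟨x, rfl⟩ | ⟨x, rfl⟩)
      · exact Or.inl (h1 v x)
      · exact Or.inr (h1 w x)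
    intro v w
    refine ⟨fun h => ?_, key v w⟩
    have := key _ _ h
    simpa [hf] using this⟩

/-- The automorphism `a` of the binary tree. -/
def grigorchukA : TreeAut 2 := treeAutOfInvolution grigA grigA_grigA rfl grigA_concat

/-- The automorphisms `b`, `c`, `d` of the binary tree, for the indices `0`, `1`, `2`. -/
def grigorchukB (k : Fin 3) : TreeAut 2 :=
  treeAutOfInvolution (grigB k) (grigB_grigB k) rfl (grigB_concat k)

/-- The (first) Grigorchuk group. -/
def grigorchukGroup : Subgroup (TreeAut 2) :=
  Subgroup.closure {grigorchukA, grigorchukB 0, grigorchukB 1, grigorchukB 2}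

theorem treeSection_mul (g h : TreeAut d) (v : List (Fin d)) :
    treeSection (g * h) v = treeSection g (h.1 v) * treeSection h v := by
  refine treeSection_unique _ _ _ fun w => ?_
  change g.1 (h.1 (v ++ w)) = g.1 (h.1 v) ++ (treeSection g (h.1 v)).1 ((treeSection h v).1 w)
  rw [treeSection_spec h, treeSection_spec g]

theorem treeSection_inv (g : TreeAut d) (v : List (Fin d)) :
    treeSection g⁻¹ v = (treeSection g (g⁻¹.1 v))⁻¹ := by
  have := treeSection_mul g g⁻¹ v
  rw [mul_inv_cancel, treeSection_unique 1 1 v fun _ => rfl] at this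
  exact eq_inv_of_mul_eq_one_right this.symm

theorem treeSection_append (g : TreeAut d) (v w : List (Fin d)) :
    treeSection g (v ++ w) = treeSection (treeSection g v) w := by
  refine treeSection_unique _ _ _ fun t => ?_
  rw [List.append_assoc, treeSection_spec g v, treeSection_spec g v w, List.append_assoc,
    ← treeSection_spec, ← treeSection_spec]
  exact treeSection_spec g v (w ++ t)

theorem treeSection_nil (g : TreeAut d) : treeSection g [] = g :=
  treeSection_unique _ _ _ fun w => by rw [g.map_nil]; rfl

/-- Self-similarity can be checked on the sections of level one of a generating set. -/
theorem isSelfSimilar_closure {S : Set (TreeAut d)}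
    (h : ∀ s ∈ S, ∀ x : Fin d, treeSection s [x] ∈ Subgroup.closure S) :
    IsSelfSimilar (Subgroup.closure S) := by
  have h1 : ∀ g ∈ Subgroup.closure S, ∀ x : Fin d, treeSection g [x] ∈ Subgroup.closure S := by
    have hlen : ∀ (g : TreeAut d) (x : Fin d), ∃ y, g.1 [x] = [y] := fun g x => by
      obtain ⟨y, hy⟩ := g.map_concat [] x
      rw [g.map_nil] at hy
      exact ⟨y, hy⟩
    intro g hg
    induction hg using Subgroup.closure_induction with
    | mem s hs => exact h s hs
    | one => intro x; rw [treeSection_unique 1 1 [x] fun _ => rfl]; exact Subgroup.one_mem _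
    | mul a b _ _ ha hb =>
      intro x
      obtain ⟨y, hy⟩ := hlen b x
      rw [treeSection_mul, hy]
      exact Subgroup.mul_mem _ (ha y) (hb x)
    | inv a _ ha =>
      intro x
      obtain ⟨y, hy⟩ := hlen a⁻¹ x
      rw [treeSection_inv, hy]
      exact Subgroup.inv_mem _ (ha y)
  intro g hg v
  induction v generalizing g with
  | nil => rwa [treeSection_nil]
  | cons x v ih =>
    rw [show x :: v = [x] ++ v from rfl, treeSection_append]
    exact ih _ (h1 g hg x)

theorem grigorchukGroup_isSelfSimilar : IsSelfSimilar grigorchukGroup := by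
  refine isSelfSimilar_closure ?_
  have ha : grigorchukA ∈ Subgroup.closure
      {grigorchukA, grigorchukB 0, grigorchukB 1, grigorchukB 2} :=
    Subgroup.subset_closure (by simp)
  have hb : ∀ k, grigorchukB k ∈ Subgroup.closure
      {grigorchukA, grigorchukB 0, grigorchukB 1, grigorchukB 2} := fun k =>
    Subgroup.subset_closure (by fin_cases k <;> simp)
  have hsa : ∀ x, treeSection grigorchukA [x] = 1 := fun x =>
    treeSection_unique _ _ _ fun w => rfl
  have hs0 : ∀ k, treeSection (grigorchukB k) [0] = if k = 2 then 1 else grigorchukA := by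
    intro k
    refine treeSection_unique _ _ _ fun w => ?_
    by_cases hk : k = 2
    · simp [hk, grigorchukB, treeAutOfInvolution, grigB]
    · simp [hk, grigorchukB, grigorchukA, treeAutOfInvolution, grigB, grigA]
  have hs1 : ∀ k, treeSection (grigorchukB k) [1] = grigorchukB (k + 1) := by
    intro k
    refine treeSection_unique _ _ _ fun w => ?_
    simp [grigorchukB, treeAutOfInvolution, grigB]
  have hsb : ∀ k x, treeSection (grigorchukB k) [x] ∈ Subgroup.closure
      {grigorchukA, grigorchukB 0, grigorchukB 1, grigorchukB 2} := by
    intro k x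
    by_cases hx : x = 0
    · rw [hx, hs0]
      split_ifs
      · exact Subgroup.one_mem _
      · exact ha
    · have : x = 1 := by omega
      rw [this, hs1]
      exact hb _
  rintro s (rfl | rfl | rfl | rfl) x
  · rw [hsa]; exact Subgroup.one_mem _
  all_goals exact hsb _ x

end TreeAA

open TreeAA

/-! Everything rests on two facts about a self-similar group `L` with a subgroup `K` that is
branching (`levelOneProduct K ≤ K`) and contains the stabilizer in `L` of a level `M`. Sections in
`K` can be prescribed freely at a level (`exists_sections`). Conversely, a homeomorphism that fixes
the leaves of a complete subtree and acts by `K` below them comes from `K`, by gluing upwards from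
the leaves (`exists_eq_boundaryHom`). If `γ` is piecewise of type `L` and `g` in `L` fixes a deep
level, then `γgγ⁻¹` is of this kind, so `γ` conjugates deep level stabilizers of `L` into given ones
(`exists_conj_levelStabilizer`). For `L = H` this gives commensuration. The hypotheses on `K` pass
to closures with the same `M`, and for `L = G`, the closure of `H`, the level stabilizers then form
a basis at the identity of a group topology on `AAut_G`. Uniqueness holds because a group topology
is determined by its neighborhoods of the identity.

The completion is identified by a general principle (`exists_schlichting_iso`): if `Γ` is mapped
densely to `Δ`, and `Λ` is the preimage of a compact open subgroup of `Δ` with trivial core, then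
the completion of `Γ` with respect to `Λ` is `Δ`. Density follows from `AAut_G = AAut_H · G`
(`exists_mem_AAut_mul`), where the sections in `G` are corrected to sections in `H` by an element of
the closure of `K`. The preimage of `G` is `H` (`mem_of_boundaryHom_mem_AAut`). The core is trivial
because exchanging cones of different depths conjugates a nontrivial tree automorphism to a map that
does not preserve depth (`eq_one_of_forall_conj_mem`).

For the Grigorchuk group, `K` is the normal closure of `(ab)²`. It is branching because it contains
`((ab)², 1)`. It contains the stabilizer of level 3: every element is `bⁱ(ad)ʲaᵏκ` with `κ` in `K`,
and parities of the activity on the first levels detect the exponents. -/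

namespace TreeAA

variable {d : ℕ}

/-! ### Automorphisms with prescribed sections -/

/-- Permutations of the vertices that send children to children, in both directions. -/
def treeAutOfConcat (f : Equiv.Perm (List (Fin d))) (h0 : f [] = [])
    (h1 : ∀ v x, ∃ y, f (v ++ [x]) = f v ++ [y])
    (h2 : ∀ v x, ∃ y, f.symm (v ++ [x]) = f.symm v ++ [y]) : TreeAut d :=
  ⟨f, h0, by
    have key : ∀ g : Equiv.Perm (List (Fin d)), (∀ v x, ∃ y, g (v ++ [x]) = g v ++ [y]) →
        ∀ v w, (regularTree d).Adj v w → (regularTree d).Adj (g v) (g w) := by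
      rintro g hg v w (⟨x, rfl⟩ | ⟨x, rfl⟩)
      · exact Or.inl (hg v x)
      · exact Or.inr (hg w x)
    intro v w
    refine ⟨fun h => ?_, key f h1 v w⟩
    simpa using key f.symm h2 _ _ h⟩

/-- The vertex map that fixes the first level and acts by `k x` below the letter `x`. -/
def glueFun (k : Fin d → TreeAut d) : List (Fin d) → List (Fin d)
  | [] => []
  | x :: w => x :: (k x).1 w

theorem glueFun_concat (k : Fin d → TreeAut d) (v : List (Fin d)) (x : Fin d) :
    ∃ y, glueFun k (v ++ [x]) = glueFun k v ++ [y] := by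
  cases v with
  | nil => exact ⟨x, by simp [glueFun, TreeAut.map_nil]⟩
  | cons z v =>
    obtain ⟨y, hy⟩ := (k z).map_concat v x
    exact ⟨y, by simp [glueFun, hy]⟩

/-- The automorphism that fixes the first level and has the section `k x` at the letter `x`. -/
def glue (k : Fin d → TreeAut d) : TreeAut d :=
  treeAutOfConcat
    { toFun := glueFun k
      invFun := glueFun fun x => (k x)⁻¹
      left_inv := fun v => by cases v <;> simp [glueFun]
      right_inv := fun v => by cases v <;> simp [glueFun] }
    rfl (glueFun_concat k) (glueFun_concat _)

@[simp] theorem glue_cons (k : Fin d → TreeAut d) (x : Fin d) (w : List (Fin d)) :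
    (glue k).1 (x :: w) = x :: (k x).1 w := rfl

@[simp] theorem treeSection_glue (k : Fin d → TreeAut d) (x : Fin d) :
    treeSection (glue k) [x] = k x :=
  treeSection_unique _ _ _ fun w => by simp [TreeAut.map_nil]

theorem glue_mem_levelOneProduct {K : Subgroup (TreeAut d)} {k : Fin d → TreeAut d}
    (hk : ∀ x, k x ∈ K) : glue k ∈ levelOneProduct K := fun x =>
  ⟨by simp [TreeAut.map_nil], by simpa using hk x⟩

/-- Sections in a branching subgroup, prescribed on one level, come from an element of it. -/
theorem exists_sections {K : Subgroup (TreeAut d)} (hK : levelOneProduct K ≤ K) (n : ℕ)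
    (k : List (Fin d) → TreeAut d) (hk : ∀ v, v.length = n → k v ∈ K) :
    ∃ κ ∈ K, ∀ v, v.length = n → κ.1 v = v ∧ treeSection κ v = k v := by
  induction n generalizing k with
  | zero =>
    refine ⟨k [], hk _ rfl, fun v hv => ?_⟩
    obtain rfl := List.eq_nil_of_length_eq_zero hv
    exact ⟨TreeAut.map_nil _, treeSection_nil _⟩
  | succ n ih =>
    have := fun x : Fin d => ih (fun v => k (x :: v)) fun v hv => hk _ (by simp [hv])
    choose κ hκ h using this
    refine ⟨glue κ, hK (glue_mem_levelOneProduct hκ), fun v hv => ?_⟩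
    cases v with
    | nil => simp at hv
    | cons x v =>
      obtain ⟨h1, h2⟩ := h x v (by simpa using hv)
      refine ⟨by simp [h1], ?_⟩
      rw [show x :: v = [x] ++ v from rfl, treeSection_append, treeSection_glue, h2]
      rfl

/-- An automorphism that fixes some level and has its sections there in a branching subgroup
belongs to that subgroup. -/
theorem mem_of_sections [NeZero d] {K : Subgroup (TreeAut d)} (hK : levelOneProduct K ≤ K)
    {κ : TreeAut d} (n : ℕ)
    (h : ∀ v : List (Fin d), v.length = n → κ.1 v = v ∧ treeSection κ v ∈ K) : κ ∈ K := by
  induction n with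
  | zero => simpa [treeSection_nil] using (h [] rfl).2
  | succ n ih =>
    refine ih fun v hv => ?_
    have h1 : ∀ x, κ.1 (v ++ [x]) = v ++ [x] ∧ treeSection κ (v ++ [x]) ∈ K := fun x =>
      h _ (by simp [hv])
    -- A fixed child forces its parent to be fixed. The letter `0` exists because `d` is nonzero.
    have h2 : κ.1 v = v := by
      have := (h1 0).1
      rw [treeSection_spec] at this
      exact List.append_inj_left this (κ.length_map v)
    refine ⟨h2, hK fun x => ⟨?_, ?_⟩⟩
    · have := (h1 x).1
      rw [treeSection_spec, h2] at this
      exact List.append_cancel_left this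
    · rw [← treeSection_append]
      exact (h1 x).2

/-! ### Level stabilizers -/

/-- A shorter word is extended to level `n` by repeating its own first letter, so that no assumption
on `d` is needed. -/
theorem apply_eq_of_length_le {g h : TreeAut d} {n : ℕ}
    (H : ∀ v : List (Fin d), v.length = n → g.1 v = h.1 v) {v : List (Fin d)}
    (hv : v.length ≤ n) : g.1 v = h.1 v := by
  cases v with
  | nil => rw [g.map_nil, h.map_nil]
  | cons x v =>
    have := H ((x :: v) ++ List.replicate (n - (x :: v).length) x) (by simp at hv ⊢; omega)
    rw [treeSection_spec, treeSection_spec] at this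
    exact List.append_inj_left this (by rw [g.length_map, h.length_map])

theorem mem_levelStabilizer_iff {g : TreeAut d} {n : ℕ} :
    g ∈ levelStabilizer d n ↔ ∀ v : List (Fin d), v.length ≤ n → g.1 v = v :=
  ⟨fun h _ hv => apply_eq_of_length_le (h := 1) h hv, fun h _ hv => h _ hv.le⟩

theorem levelStabilizer_antitone : Antitone (levelStabilizer d) := fun _ _ hmn _ hg =>
  mem_levelStabilizer_iff.2 fun v hv => mem_levelStabilizer_iff.1 hg v (hv.trans hmn)

theorem inv_mul_mem_levelStabilizer_iff {g h : TreeAut d} {n : ℕ} :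
    h⁻¹ * g ∈ levelStabilizer d n ↔ ∀ v : List (Fin d), v.length ≤ n → g.1 v = h.1 v := by
  rw [mem_levelStabilizer_iff]
  refine forall₂_congr fun v _ => ?_
  change h.1⁻¹ (g.1 v) = v ↔ _
  rw [Equiv.Perm.inv_eq_iff_eq]

theorem treeSection_mem_levelStabilizer {g : TreeAut d} {m n : ℕ}
    (hg : g ∈ levelStabilizer d (m + n)) {v : List (Fin d)} (hv : v.length ≤ m) :
    treeSection g v ∈ levelStabilizer d n := mem_levelStabilizer_iff.2 fun w hw => by
  rw [mem_levelStabilizer_iff] at hg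
  have := hg (v ++ w) (by simp; omega)
  rw [treeSection_spec, hg v (by omega)] at this
  exact List.append_cancel_left this

theorem conj_mem_levelStabilizer {g : TreeAut d} {n : ℕ} (hg : g ∈ levelStabilizer d n)
    (h : TreeAut d) : h * g * h⁻¹ ∈ levelStabilizer d n := fun v hv => by
  change h.1 (g.1 (h⁻¹.1 v)) = v
  rw [hg _ (by rw [TreeAut.length_map, hv])]
  simp

/-- The product even fixes level `n + 1`. The weaker form says that level stabilizers are branching,
so that intersecting a branching subgroup with one keeps it branching. -/
theorem levelOneProduct_levelStabilizer_le (n : ℕ) :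
    levelOneProduct (levelStabilizer d n) ≤ levelStabilizer d n := fun g hg =>
  mem_levelStabilizer_iff.2 fun v hv => by
    cases v with
    | nil => exact g.map_nil
    | cons x v =>
      rw [show x :: v = [x] ++ v from rfl, treeSection_spec, (hg x).1,
        mem_levelStabilizer_iff.1 (hg x).2 v (by simp at hv; omega)]

theorem levelOneProduct_inf (K L : Subgroup (TreeAut d)) :
    levelOneProduct (K ⊓ L) = levelOneProduct K ⊓ levelOneProduct L := by
  ext g
  exact ⟨fun h => ⟨fun x => ⟨(h x).1, (h x).2.1⟩, fun x => ⟨(h x).1, (h x).2.2⟩⟩,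
    fun h x => ⟨(h.1 x).1, (h.1 x).2, (h.2 x).2⟩⟩

/-! ### Local actions of boundary homeomorphisms -/

theorem actsOn_boundaryHom (g : TreeAut d) (v : List (Fin d)) :
    ActsOn (boundaryHom d g) v (g.1 v) (treeSection g v) := by
  intro w ξ hξ
  change pref (boundaryMap g ξ) _ = _
  rw [← treeSection_spec, pref_boundaryMap, g.length_map]
  exact congrArg _ hξ

theorem eq_boundaryHom_of_actsOn {φ : Boundary d ≃ₜ Boundary d} {g : TreeAut d}
    (h : ActsOn φ [] [] g) : φ = boundaryHom d g := Homeomorph.ext fun ξ => ext_pref fun n => by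
  have := h (pref ξ n) ξ (through_pref ξ n)
  unfold Through at this
  change _ = pref (boundaryMap g ξ) n
  rw [pref_boundaryMap]
  simpa [g.length_map] using this

theorem boundaryHom_injective [NeZero d] : Function.Injective (boundaryHom d) := by
  intro g h hgh
  refine Subtype.ext (Equiv.ext fun v => ?_)
  obtain ⟨ξ, hξ⟩ := exists_through v
  have := congrArg (fun φ : Boundary d ≃ₜ Boundary d => pref (φ ξ) v.length) hgh
  change pref (boundaryMap g ξ) _ = pref (boundaryMap h ξ) _ at this
  rwa [pref_boundaryMap, pref_boundaryMap, hξ] at this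

/-- A homeomorphism acting on the cone of `v` in two ways: the target vertex is unique. -/
theorem ActsOn.target_length_le (hd : 2 ≤ d) {φ : Boundary d ≃ₜ Boundary d}
    {v u u' : List (Fin d)} {g g' : TreeAut d} (h : ActsOn φ v u g) (h' : ActsOn φ v u' g') :
    u.length ≤ u'.length := by
  have : NeZero d := ⟨by omega⟩
  by_contra! hlt
  -- The identity would carry the cone of `u'` onto the cone of the longer word `u`. Then `u`
  -- extends every child of `u'`, which is impossible for two distinct children.
  have h1 : ActsOn 1 u' u (g * g'⁻¹) := by simpa using h'.inv.mul h
  have h2 : ∀ ξ, Through ξ u' → Through ξ u := fun ξ hξ => by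
    simpa [TreeAut.map_nil] using (h1 [] ξ (by simpa using hξ)).of_append
  have h3 : ∀ x, u' ++ [x] <+: u := fun x => by
    obtain ⟨ξ, hξ⟩ := exists_through (u' ++ [x])
    exact hξ.prefix_of_le (h2 ξ hξ.of_append) (by simpa using hlt)
  have h4 := List.prefix_of_prefix_length_le (h3 ⟨0, by omega⟩) (h3 ⟨1, by omega⟩) (by simp)
  have h5 := h4.eq_of_length (by simp)
  simp at h5

theorem Through.eq_of_length_eq {ξ : Boundary d} {v w : List (Fin d)} (hv : Through ξ v)
    (hw : Through ξ w) (h : v.length = w.length) : v = w :=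
  (hv.prefix_of_le hw h.le).eq_of_length h

/-- Once the targets have equal length, a ray through `vw` determines the image vertex of `vw` as a
prefix of its image. With `d = 1` the boundary is a point and the target would be arbitrary. -/
theorem ActsOn.unique (hd : 2 ≤ d) {φ : Boundary d ≃ₜ Boundary d}
    {v u u' : List (Fin d)} {g g' : TreeAut d} (h : ActsOn φ v u g) (h' : ActsOn φ v u' g') :
    u = u' ∧ g = g' := by
  have : NeZero d := ⟨by omega⟩
  have hl := (h.target_length_le hd h').antisymm (h'.target_length_le hd h)
  have key : ∀ w, u ++ g.1 w = u' ++ g'.1 w := fun w => by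
    obtain ⟨ξ, hξ⟩ := exists_through (v ++ w)
    exact (h w ξ hξ).eq_of_length_eq (h' w ξ hξ) (by simp [TreeAut.length_map, hl])
  have hu : u = u' := by simpa [TreeAut.map_nil] using key []
  subst hu
  exact ⟨rfl, Subtype.ext (Equiv.ext fun w => List.append_cancel_left (key w))⟩

theorem actsOn_glue {φ : Boundary d ≃ₜ Boundary d} {v u : List (Fin d)} {k : Fin d → TreeAut d}
    (h : ∀ x, ActsOn φ (v ++ [x]) (u ++ [x]) (k x)) : ActsOn φ v u (glue k) := by
  intro w ξ hξ
  cases w with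
  | nil =>
    have h1 : Through ξ (v ++ [ξ v.length]) := by
      have : Through ξ v := by simpa using hξ
      unfold Through at this ⊢
      rw [List.length_append, List.length_singleton, pref_succ, this]
    have := (h _ [] ξ (by simpa using h1)).of_append.of_append
    simpa [TreeAut.map_nil] using this
  | cons x w =>
    have := h x w ξ (by simpa using hξ)
    simpa using this

/-- A homeomorphism that fixes the leaves of a finite complete subtree, and acts below them by
elements of a branching subgroup `K`, is given by an element of `K`. -/
theorem exists_eq_boundaryHom {K : Subgroup (TreeAut d)} (hK : levelOneProduct K ≤ K)
    (T : CompleteSubtree d) {φ : Boundary d ≃ₜ Boundary d}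
    (h : ∀ u ∈ T.leaves, ∃ k ∈ K, ActsOn φ u u k) : ∃ k ∈ K, φ = boundaryHom d k := by
  obtain ⟨N, hN⟩ := (T.finite.image List.length).bddAbove
  -- Induction from the leaves to the root: `n` bounds the distance from `u` to depth `N + 1`, below
  -- all of `T`, so the case `n = 0` is vacuous. A vertex that is not a leaf has all its children in
  -- `T`, and their local actions are glued within `K`.
  have key : ∀ n, ∀ u ∈ T.verts, N + 1 ≤ u.length + n → ∃ k ∈ K, ActsOn φ u u k := by
    intro n
    induction n with
    | zero =>
      intro u hu h1
      have := hN ⟨u, hu, rfl⟩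
      omega
    | succ n ih =>
      intro u hu h1
      by_cases hl : u ∈ T.leaves
      · exact h u hl
      · have : ∃ x, u ++ [x] ∈ T.verts := by
          by_contra! hc
          exact hl ⟨hu, hc⟩
        obtain ⟨x, hx⟩ := this
        have := fun y : Fin d => ih (u ++ [y]) (T.children_mem u x y hx) (by simp; omega)
        choose k hk hk' using this
        exact ⟨glue k, hK (glue_mem_levelOneProduct hk), actsOn_glue hk'⟩
  obtain ⟨k, hk, h1⟩ := key (N + 1) [] T.root_mem (by simp)
  exact ⟨k, hk, eq_boundaryHom_of_actsOn h1⟩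

/-- Almost automorphisms conjugate small level stabilizers into level stabilizers. -/
theorem exists_conj_levelStabilizer {G K : Subgroup (TreeAut d)} (hG : IsSelfSimilar G)
    (hKG : K ≤ G) (hK : levelOneProduct K ≤ K) {M : ℕ} (hM : G ⊓ levelStabilizer d M ≤ K)
    {γ : Boundary d ≃ₜ Boundary d} (hγ : IsPiecewise G γ) (n : ℕ) :
    ∃ m, ∀ g ∈ G ⊓ levelStabilizer d m, ∃ k ∈ G ⊓ levelStabilizer d n,
      γ * boundaryHom d g * γ⁻¹ = boundaryHom d k := by
  obtain ⟨T, T', ψ, hψ, hl⟩ := hγ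
  obtain ⟨N, hN⟩ := (T.finite.image List.length).bddAbove
  -- The leaves of `T` have depth at most `N`, so the sections of `g` there fix level `max M n`: `M`
  -- serves for membership in `K`, and `n` for the target stabilizer.
  refine ⟨N + max M n, fun g hg => ?_⟩
  have hK' : levelOneProduct (K ⊓ levelStabilizer d n) ≤ K ⊓ levelStabilizer d n := by
    rw [levelOneProduct_inf]
    exact inf_le_inf hK (levelOneProduct_levelStabilizer_le n)
  obtain ⟨k, hk, h⟩ := exists_eq_boundaryHom hK' T' (φ := γ * boundaryHom d g * γ⁻¹) fun u hu => by
    obtain ⟨v, hv⟩ := ψ.leafEquiv.surjective ⟨u, hu⟩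
    have hvN : v.1.length ≤ N := hN ⟨v, v.2.1, rfl⟩
    have h1 : ActsOn γ v u (ψ.label v) := by simpa [hv] using hψ v
    have h2 := actsOn_boundaryHom g v
    rw [mem_levelStabilizer_iff.1 hg.2 v (by omega)] at h2
    refine ⟨_, ?_, (h1.inv.mul h2).mul h1⟩
    -- `K` need not be normal in `G`, but level stabilizers are normal in the whole automorphism
    -- group. The conjugate is therefore put in `K` only afterwards, through `hM`.
    have h3 := conj_mem_levelStabilizer (treeSection_mem_levelStabilizer hg.2 hvN) (ψ.label v)
    rw [← mul_assoc]
    exact ⟨hM ⟨G.mul_mem (G.mul_mem (hl v) (hG g hg.1 v)) (G.inv_mem (hl v)),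
      levelStabilizer_antitone (le_max_left _ _) h3⟩,
      levelStabilizer_antitone (le_max_right _ _) h3⟩
  exact ⟨k, ⟨hKG hk.1, hk.2⟩, h⟩

/-! ### The topology of the automorphism group of the tree -/

/-- A basic neighborhood constrains finitely many vertices, which lie above some level; conversely,
each level is finite. -/
theorem nhds_one_hasBasis_levelStabilizer (d : ℕ) :
    (𝓝 (1 : TreeAut d)).HasBasis (fun _ : ℕ => True) fun n => (levelStabilizer d n : Set (TreeAut d)) := by
  refine ⟨fun s => ?_⟩
  have hopen : ∀ v : List (Fin d), {g : TreeAut d | g.1 v = v} ∈ 𝓝 (1 : TreeAut d) := fun v =>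
    ((isOpen_perm_apply v v).preimage continuous_subtype_val).mem_nhds rfl
  constructor
  · intro hs
    let _ : TopologicalSpace (List (Fin d)) := ⊥
    have : DiscreteTopology (List (Fin d)) := ⟨rfl⟩
    rw [nhds_subtype_eq_comap, nhds_induced, Filter.comap_comap, Filter.mem_comap] at hs
    obtain ⟨t, ht, hts⟩ := hs
    rw [nhds_pi, Filter.mem_pi] at ht
    obtain ⟨I, hI, u, hu, hut⟩ := ht
    obtain ⟨N, hN⟩ := (hI.image List.length).bddAbove
    refine ⟨N, trivial, fun g hg => hts (hut fun v hv => ?_)⟩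
    have : g.1 v = v := mem_levelStabilizer_iff.1 hg v (hN ⟨v, hv, rfl⟩)
    change g.1 v ∈ u v
    rw [this]
    exact mem_of_mem_nhds (hu v)
  · rintro ⟨n, -, hn⟩
    refine Filter.mem_of_superset ?_ hn
    have := (Filter.biInter_mem (List.finite_length_eq (Fin d) n)).2 fun v _ => hopen v
    refine Filter.mem_of_superset this fun g hg v hv => ?_
    simpa using Set.mem_iInter₂.1 hg v hv

theorem isOpen_levelStabilizer (d n : ℕ) : IsOpen (levelStabilizer d n : Set (TreeAut d)) :=
  Subgroup.isOpen_of_mem_nhds _ ((nhds_one_hasBasis_levelStabilizer d).mem_of_mem trivial)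

/-- The closure consists of the elements that agree on each level with some element of `H`, because
the level stabilizers are a basis at the identity. -/
theorem mem_topologicalClosure_iff {H : Subgroup (TreeAut d)} {g : TreeAut d} :
    g ∈ H.topologicalClosure ↔ ∀ n, ∃ h ∈ H, h⁻¹ * g ∈ levelStabilizer d n := by
  constructor
  · intro hg n
    have ho : IsOpen ((fun h : TreeAut d => h⁻¹ * g) ⁻¹' (levelStabilizer d n)) :=
      (isOpen_levelStabilizer d n).preimage (by fun_prop)
    obtain ⟨h, h1, h2⟩ := mem_closure_iff.1 (show g ∈ closure (H : Set (TreeAut d)) from hg) _ ho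
      (by simp)
    exact ⟨h, h2, h1⟩
  · intro h
    change g ∈ closure (H : Set (TreeAut d))
    rw [mem_closure_iff_nhds]
    intro t ht
    have hc : Continuous fun s : TreeAut d => g * s⁻¹ := by fun_prop
    have h1 := hc.tendsto' 1 g (by simp) ht
    obtain ⟨n, -, hn⟩ := (nhds_one_hasBasis_levelStabilizer d).mem_iff.1 h1
    obtain ⟨k, hk, hkn⟩ := h n
    refine ⟨k, ?_, hk⟩
    simpa using hn hkn

/-- Automorphisms preserve length, so the pairs `(g, g⁻¹)` lie in a product of finite sets, compact
by Tychonoff. Recording the inverse turns bijectivity into equations, which are closed conditions.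
-/
instance treeAut_compactSpace (d : ℕ) : CompactSpace (TreeAut d) := by
  let _ : TopologicalSpace (List (Fin d)) := ⊥
  have : DiscreteTopology (List (Fin d)) := ⟨rfl⟩
  let V := List (Fin d)
  let P : Set (V → V) := Set.pi Set.univ fun v => {w | w.length = v.length}
  have hP : IsCompact P := isCompact_univ_pi fun v => (List.finite_length_eq (Fin d) _).isCompact
  let C : Set ((V → V) × (V → V)) := {p | (∀ v, p.2 (p.1 v) = v) ∧ (∀ v, p.1 (p.2 v) = v) ∧
    p.1 [] = [] ∧ ∀ v w, (regularTree d).Adj (p.1 v) (p.1 w) ↔ (regularTree d).Adj v w}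
  have hev : ∀ v : V, Continuous fun f : V → V => f v := fun v => continuous_apply v
  have hcomp : ∀ (v : V), Continuous fun p : (V → V) × (V → V) => p.2 (p.1 v) := fun v => by
    refine continuous_discrete_rng.2 fun y => ?_
    have : (fun p : (V → V) × (V → V) => p.2 (p.1 v)) ⁻¹' {y} =
        ⋃ z, {p : (V → V) × (V → V) | p.1 v = z} ∩ {p | p.2 z = y} := by
      ext p; simp
    rw [this]
    exact isOpen_iUnion fun z =>
      ((isOpen_discrete {z}).preimage ((hev v).comp continuous_fst)).inter
        ((isOpen_discrete {y}).preimage ((hev z).comp continuous_snd))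
  have hC : IsClosed C := by
    have h1 : IsClosed {p : (V → V) × (V → V) | ∀ v, p.2 (p.1 v) = v} := by
      simp only [Set.ofPred_forall]
      exact isClosed_iInter fun v => (isClosed_discrete {v}).preimage (hcomp v)
    have h2 : IsClosed {p : (V → V) × (V → V) | ∀ v, p.1 (p.2 v) = v} :=
      h1.preimage continuous_swap
    have h3 : IsClosed {p : (V → V) × (V → V) | p.1 [] = []} :=
      (isClosed_discrete {[]}).preimage ((hev []).comp continuous_fst)
    have h4 : IsClosed {p : (V → V) × (V → V) |
        ∀ v w, (regularTree d).Adj (p.1 v) (p.1 w) ↔ (regularTree d).Adj v w} := by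
      simp only [Set.ofPred_forall]
      exact isClosed_iInter fun v => isClosed_iInter fun w =>
        (isClosed_discrete {q : V × V | (regularTree d).Adj q.1 q.2 ↔ (regularTree d).Adj v w}).preimage
          (((hev v).comp continuous_fst).prodMk ((hev w).comp continuous_fst))
    exact h1.inter (h2.inter (h3.inter h4))
  have hK : IsCompact (P ×ˢ P ∩ C) := (hP.prod hP).inter_right hC
  have := isCompact_iff_compactSpace.1 hK
  let F : ↥(P ×ˢ P ∩ C) → TreeAut d := fun p =>
    ⟨⟨p.1.1, p.1.2, p.2.2.1, p.2.2.2.1⟩, p.2.2.2.2⟩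
  have hF : Continuous F := by
    refine Continuous.subtype_mk (continuous_induced_rng.2 ?_) _
    exact continuous_fst.comp continuous_subtype_val
  refine Function.Surjective.compactSpace (f := F) hF fun g => ?_
  exact ⟨⟨(g.1, (g⁻¹).1), ⟨fun v _ => g.length_map v, fun v _ => (g⁻¹).length_map v⟩,
    fun v => by simp, fun v => by simp, g.2⟩, rfl⟩

theorem levelStabilizer_finiteIndex (d n : ℕ) : (levelStabilizer d n).FiniteIndex := by
  have := Subgroup.quotient_finite_of_isOpen _ (isOpen_levelStabilizer d n)
  exact Subgroup.finiteIndex_of_finite_quotient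

/-! ### Schlichting completions and dense embeddings -/

section Schlichting

variable {Γ Δ : Type*} [Group Γ] [Group Δ]

/-- If `j(Γ)U = Δ`, then the coset spaces `Γ/j⁻¹(U)` and `Δ/U` are isomorphic as `Γ`-sets. -/
theorem exists_quotient_comap_equiv (U : Subgroup Δ) (j : Γ →* Δ)
    (h : ∀ x : Δ, ∃ γ, (j γ)⁻¹ * x ∈ U) :
    ∃ e : Γ ⧸ U.comap j ≃ Δ ⧸ U, ∀ γ : Γ, e (γ : Γ ⧸ U.comap j) = (j γ : Δ ⧸ U) := by
  have hrel : ∀ a b : Γ, (a : Γ ⧸ U.comap j) = b ↔ (j a : Δ ⧸ U) = j b := fun a b => by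
    rw [QuotientGroup.eq, QuotientGroup.eq, Subgroup.mem_comap, map_mul, map_inv]
  let f : Γ ⧸ U.comap j → Δ ⧸ U := Quotient.lift (fun γ => (j γ : Δ ⧸ U)) fun a b hab =>
    (hrel a b).1 (Quotient.sound hab)
  have hf : ∀ γ : Γ, f (γ : Γ ⧸ U.comap j) = (j γ : Δ ⧸ U) := fun _ => rfl
  refine ⟨Equiv.ofBijective f ⟨fun p q hpq => ?_, fun y => ?_⟩, hf⟩
  · obtain ⟨a, rfl⟩ := QuotientGroup.mk_surjective p
    obtain ⟨b, rfl⟩ := QuotientGroup.mk_surjective q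
    exact (hrel a b).2 hpq
  · obtain ⟨x, rfl⟩ := QuotientGroup.mk_surjective y
    obtain ⟨γ, hγ⟩ := h x
    exact ⟨γ, QuotientGroup.eq.2 hγ⟩

variable [TopologicalSpace Δ] [IsTopologicalGroup Δ]

/-- The Schlichting completion of a group `Γ` that is mapped densely to a topological group `Δ`,
with respect to the preimage of a compact open subgroup of `Δ` with trivial core, is `Δ`. -/
theorem exists_schlichting_iso {U : Subgroup Δ} (hUo : IsOpen (U : Set Δ))
    (hUc : IsCompact (U : Set Δ)) (hcore : ∀ g : Δ, (∀ x, x⁻¹ * g * x ∈ U) → g = 1)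
    {j : Γ →* Δ} (hj : DenseRange j) {Λ : Subgroup Γ} (hΛ : Λ = U.comap j) :
    ∃ Φ : SchlichtingCompletion Γ Λ ≃ₜ* Δ, ∀ γ, Φ (toSchlichting Γ Λ γ) = j γ := by
  subst hΛ
  have hjU : ∀ x : Δ, ∃ γ, (j γ)⁻¹ * x ∈ U := fun x => by
    have ho : IsOpen ((fun y : Δ => y⁻¹ * x) ⁻¹' U) := hUo.preimage (by fun_prop)
    obtain ⟨y, hy, γ, rfl⟩ := hj.inter_open_nonempty _ ho ⟨x, by simp⟩
    exact ⟨γ, hy⟩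
  obtain ⟨e, he⟩ := exists_quotient_comap_equiv U j hjU
  let X := Γ ⧸ U.comap j
  let C := SchlichtingCompletion Γ (U.comap j)
  -- The action of `Δ` on `Δ/U`, transported to `Γ/j⁻¹(U)`, extends the action of `Γ`. The claim
  -- becomes that `ρ` is a homeomorphism onto the closure of the image of `Γ`.
  let ρ : Δ →* Equiv.Perm X := (e.symm.permCongrHom.toMonoidHom).comp (MulAction.toPermHom Δ (Δ ⧸ U))
  have hρ : ∀ (x : Δ) (q : X), ρ x q = e.symm (x • e q) := fun _ _ => rfl
  have hρj : ∀ γ, ρ (j γ) = MulAction.toPermHom Γ X γ := fun γ => by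
    ext q
    obtain ⟨a, rfl⟩ := QuotientGroup.mk_surjective q
    rw [hρ, e.symm_apply_eq]
    change _ = e ((γ * a : Γ) : X)
    rw [he, he, map_mul]
    rfl
  have hρc : Continuous ρ := continuous_perm _ fun q r => by
    obtain ⟨a, ha⟩ := QuotientGroup.mk_surjective (e q)
    obtain ⟨b, hb⟩ := QuotientGroup.mk_surjective (e r)
    have : {t | ρ t q = r} = (fun t => (t * a)⁻¹ * b) ⁻¹' (U : Set Δ) := by
      ext t
      change ρ t q = r ↔ (t * a)⁻¹ * b ∈ U
      rw [hρ, e.symm_apply_eq, ← ha, ← hb, ← QuotientGroup.eq]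
      rfl
    rw [this]
    exact hUo.preimage (by fun_prop)
  have hρi : Function.Injective ρ := (injective_iff_map_eq_one ρ).2 fun g hg => hcore g fun x => by
    have h1 : ρ g (e.symm (x : Δ ⧸ U)) = e.symm (x : Δ ⧸ U) := by rw [hg]; rfl
    rw [hρ, e.apply_symm_apply, e.symm.injective.eq_iff] at h1
    have h2 := QuotientGroup.eq.1 (show ((g * x : Δ) : Δ ⧸ U) = x from h1)
    have h3 := U.inv_mem h2
    simpa [mul_assoc] using h3
  have hT2 : T2Space (Equiv.Perm X) := by
    let _ : TopologicalSpace X := ⊥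
    have : DiscreteTopology X := ⟨rfl⟩
    exact T2Space.of_injective_continuous (f := fun (σ : Equiv.Perm X) (x : X) => σ x)
      DFunLike.coe_injective continuous_induced_dom
  have hclosed : ∀ S : Set Δ, IsClosed S → S ⊆ U → IsClosed (ρ '' S) := fun S hS hSU =>
    ((hUc.of_isClosed_subset hS hSU).image hρc).isClosed
  let o : X := ((1 : Γ) : X)
  have hbase : ∀ x, ρ x o = o ↔ x ∈ U := fun x => by
    rw [hρ, e.symm_apply_eq, he, map_one]
    change ((x * 1 : Δ) : Δ ⧸ U) = (1 : Δ) ↔ _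
    rw [QuotientGroup.eq]
    simp
  have hP0 : IsOpen {σ : Equiv.Perm X | σ o = o} := isOpen_perm_apply o o
  let R : Set (Equiv.Perm X) := Set.range (MulAction.toPermHom Γ X)
  -- Fixing `o` is an open condition, so `σ` is a limit of elements of the image of `Γ` that fix
  -- `o`. These lie in `ρ(U)`, which is compact and hence closed.
  have hRcl : ∀ σ : Equiv.Perm X, σ ∈ closure R → σ o = o → σ ∈ ρ '' U := fun σ hσ ho => by
    have h1 : σ ∈ closure ({σ : Equiv.Perm X | σ o = o} ∩ R) :=
      hP0.inter_closure ⟨ho, hσ⟩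
    refine (hclosed U (U.isClosed_of_isOpen hUo) subset_rfl).closure_subset_iff.2 ?_ h1
    rintro _ ⟨h2, γ, rfl⟩
    rw [← hρj] at h2 ⊢
    exact ⟨_, (hbase _).1 h2, rfl⟩
  have hcl : ∀ σ : Equiv.Perm X, σ ∈ (MulAction.toPermHom Γ X).range.topologicalClosure ↔
      σ ∈ closure R := fun σ => Iff.rfl
  have hmem : ∀ x, ρ x ∈ (MulAction.toPermHom Γ X).range.topologicalClosure := fun x => by
    rw [hcl]
    refine map_mem_closure hρc (hj x) ?_
    rintro _ ⟨γ, rfl⟩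
    exact ⟨γ, (hρj γ).symm⟩
  -- The image of `Γ` is transitive on `X`, so translating by an element of `Γ` reduces to a
  -- permutation that fixes `o`.
  have hsurj : ∀ σ : C, ∃ x, ρ x = σ.1 := fun σ => by
    obtain ⟨γ, hγ⟩ := QuotientGroup.mk_surjective (σ.1 o)
    have h1 : (toSchlichting Γ (U.comap j) γ⁻¹ * σ).1 ∈ ρ '' U := by
      refine hRcl _ (toSchlichting Γ (U.comap j) γ⁻¹ * σ).2 ?_
      change γ⁻¹ • σ.1 o = o
      rw [← hγ]
      change ((γ⁻¹ * γ : Γ) : X) = o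
      rw [inv_mul_cancel]
    obtain ⟨x, -, hx⟩ := h1
    refine ⟨j γ * x, ?_⟩
    rw [map_mul, hx, hρj]
    change _ * (MulAction.toPermHom Γ X γ⁻¹ * σ.1) = _
    rw [map_inv, mul_inv_cancel_left]
  let F : Δ →* C := ρ.codRestrict _ hmem
  have hFc : Continuous F := hρc.subtype_mk _
  have hFb : Function.Bijective F := by
    refine ⟨fun x y hxy => hρi (congrArg Subtype.val hxy), fun σ => ?_⟩
    obtain ⟨x, hx⟩ := hsurj σ
    exact ⟨x, Subtype.ext hx⟩
  have hFo : IsOpenMap F := by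
    rw [IsTopologicalGroup.isOpenMap_iff_nhds_one]
    intro S hS
    obtain ⟨W, hWS, hWo, hW1⟩ := mem_nhds_iff.1 (Filter.mem_map.1 hS)
    -- Compactness of `U` makes this image closed. Its complement within the stabilizer of `o` is a
    -- neighborhood of the identity, whose preimage under `F` lies in `W`.
    have h1 : IsClosed (ρ '' (U \ W)) :=
      hclosed _ ((U.isClosed_of_isOpen hUo).sdiff hWo) Set.sdiff_subset
    have h2 : IsOpen (Subtype.val ⁻¹' ({σ : Equiv.Perm X | σ o = o} ∩ (ρ '' (U \ W))ᶜ) : Set C) :=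
      (hP0.inter h1.isOpen_compl).preimage continuous_subtype_val
    refine Filter.mem_of_superset (h2.mem_nhds ⟨rfl, ?_⟩) ?_
    · rintro ⟨x, ⟨_, hxW⟩, hx⟩
      have : x = 1 := hρi (by rw [hx, map_one]; rfl)
      exact hxW (this ▸ hW1)
    · rintro σ ⟨h3, h4⟩
      obtain ⟨x, hx⟩ := hFb.2 σ
      have hx' : ρ x = σ.1 := congrArg Subtype.val hx
      have hxU : x ∈ U := (hbase x).1 (by rw [hx']; exact h3)
      have hxW : x ∈ W := by
        by_contra hc
        exact h4 ⟨x, ⟨hxU, hc⟩, hx'⟩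
      rw [← hx]
      exact hWS hxW
  let E : Δ ≃ₜ* C :=
    { MulEquiv.ofBijective F hFb with
      continuous_toFun := hFc
      continuous_invFun := ((Equiv.ofBijective F hFb).toHomeomorphOfContinuousOpen hFc hFo).symm.continuous }
  refine ⟨E.symm, fun γ => ?_⟩
  have : toSchlichting Γ (U.comap j) γ = E (j γ) := Subtype.ext (hρj γ).symm
  rw [this]
  exact E.symm_apply_apply (j γ)

end Schlichting

/-! ### Exchanging two disjoint cones -/

theorem through_append_iff {ξ : Boundary d} {v w : List (Fin d)} :
    Through ξ (v ++ w) ↔ Through ξ v ∧ Through (fun k => ξ (v.length + k)) w := by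
  unfold Through
  rw [List.length_append, pref_add]
  exact ⟨fun h => List.append_inj h (by simp), fun h => by rw [h.1, h.2]⟩

/-- Replace the prefix `v` of an infinite word by `u`. -/
def replacePrefix (v u : List (Fin d)) (ξ : Boundary d) : Boundary d := fun n =>
  if h : n < u.length then u[n] else ξ (v.length + (n - u.length))

theorem through_replacePrefix {v u w : List (Fin d)} {ξ : Boundary d} (h : Through ξ (v ++ w)) :
    Through (replacePrefix v u ξ) (u ++ w) := by
  rw [through_append_iff] at h ⊢
  constructor
  · unfold Through pref
    apply List.ext_getElem <;> simp [replacePrefix]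
  · have : (fun k => replacePrefix v u ξ (u.length + k)) = fun k => ξ (v.length + k) := by
      funext k; simp [replacePrefix]
    rw [this]
    exact h.2

theorem replacePrefix_replacePrefix {v : List (Fin d)} (u : List (Fin d)) {ξ : Boundary d}
    (h : Through ξ v) : replacePrefix u v (replacePrefix v u ξ) = ξ := by
  funext n
  unfold replacePrefix
  split_ifs with h1 h2
  · have : (pref ξ v.length)[n]? = v[n]? := congrArg (fun l => l[n]?) h
    simpa [pref, h1] using this.symm
  · omega
  · congr 1; omega

theorem continuous_replacePrefix (v u : List (Fin d)) : Continuous (replacePrefix v u) := by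
  refine continuous_pi fun n => ?_
  unfold replacePrefix
  split_ifs
  · exact continuous_const
  · exact continuous_apply _

theorem isClopen_through (v : List (Fin d)) : IsClopen {ξ : Boundary d | Through ξ v} := by
  let F : Boundary d → (Fin v.length → Fin d) := fun ξ i => ξ i
  have hF : Continuous F := continuous_pi fun i => continuous_apply _
  exact (isClopen_discrete {a : Fin v.length → Fin d | List.ofFn a = v}).preimage hF

instance (ξ : Boundary d) (v : List (Fin d)) : Decidable (Through ξ v) :=
  inferInstanceAs (Decidable (pref ξ v.length = v))

/-- Exchange the cones of `u` and `u'`. -/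
def swapConesFun (u u' : List (Fin d)) (ξ : Boundary d) : Boundary d :=
  if Through ξ u then replacePrefix u u' ξ else if Through ξ u' then replacePrefix u' u ξ else ξ

/-- Cones are clopen, so their frontiers are empty and the pieces need not match anywhere. -/
theorem continuous_swapConesFun (u u' : List (Fin d)) : Continuous (swapConesFun u u') := by
  have hfr : ∀ (v : List (Fin d)) (ξ : Boundary d), ξ ∉ frontier {ξ : Boundary d | Through ξ v} :=
    fun v ξ => by rw [(isClopen_through v).frontier_eq]; exact Set.notMem_empty ξ
  unfold swapConesFun
  refine continuous_if (fun ξ h => absurd h (hfr u ξ)) (continuous_replacePrefix _ _).continuousOn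
    (Continuous.continuousOn ?_)
  exact continuous_if (fun ξ h => absurd h (hfr u' ξ)) (continuous_replacePrefix _ _).continuousOn
    continuousOn_id

theorem swapConesFun_involutive {u u' : List (Fin d)}
    (h : ∀ ξ : Boundary d, Through ξ u → ¬ Through ξ u') :
    Function.Involutive (swapConesFun u u') := by
  intro ξ
  by_cases h1 : Through ξ u
  · have h2 : Through (replacePrefix u u' ξ) u' := by
      simpa using through_replacePrefix (u := u') (w := []) (by simpa using h1)
    have h3 : ¬ Through (replacePrefix u u' ξ) u := fun h3 => h _ h3 h2
    simp [swapConesFun, h1, h2, h3, replacePrefix_replacePrefix]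
  · by_cases h2 : Through ξ u'
    · have h3 : Through (replacePrefix u' u ξ) u := by
        simpa using through_replacePrefix (u := u) (w := []) (by simpa using h2)
      simp [swapConesFun, h1, h2, h3, replacePrefix_replacePrefix]
    · simp [swapConesFun, h1, h2]

/-- For incomparable vertices `u`, `u'`, there is an almost automorphism, of any type, that
exchanges the cones of `u` and `u'` and is the identity elsewhere. -/
theorem exists_swapCones {G : Subgroup (TreeAut d)} (hG : IsSelfSimilar G) {u u' : List (Fin d)}
    (h : ∀ ξ : Boundary d, Through ξ u → ¬ Through ξ u') :
    ∃ φ ∈ AAut G hG, ActsOn φ u u' 1 ∧ ActsOn φ u' u 1 ∧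
      ∀ v, (∀ ξ : Boundary d, Through ξ v → ¬ Through ξ u ∧ ¬ Through ξ u') → ActsOn φ v v 1 := by
  let φ : Boundary d ≃ₜ Boundary d :=
    { (swapConesFun_involutive h).toPerm with
      continuous_toFun := continuous_swapConesFun u u'
      continuous_invFun := continuous_swapConesFun u u' }
  have h1 : ActsOn φ u u' 1 := fun w ξ hξ => by
    change Through (swapConesFun u u' ξ) (u' ++ w)
    rw [swapConesFun, if_pos hξ.of_append]
    exact through_replacePrefix hξ
  have h2 : ActsOn φ u' u 1 := fun w ξ hξ => by
    change Through (swapConesFun u u' ξ) (u ++ w)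
    rw [swapConesFun, if_neg fun h' => h ξ h' hξ.of_append, if_pos hξ.of_append]
    exact through_replacePrefix hξ
  have h3 : ∀ v, (∀ ξ : Boundary d, Through ξ v → ¬ Through ξ u ∧ ¬ Through ξ u') →
      ActsOn φ v v 1 := fun v hv w ξ hξ => by
    change Through (swapConesFun u u' ξ) (v ++ w)
    obtain ⟨h4, h5⟩ := hv ξ hξ.of_append
    rw [swapConesFun, if_neg h4, if_neg h5]
    exact hξ
  -- A vertex at this depth lies below `u`, below `u'`, or is incomparable with both.
  refine ⟨φ, UniformAt.isPiecewise (n := max u.length u'.length) hG fun v hv => ?_, h1, h2, h3⟩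
  by_cases h4 : u <+: v
  · obtain ⟨t, rfl⟩ := h4
    exact ⟨_, _, hG 1 G.one_mem t, h1.append t⟩
  by_cases h5 : u' <+: v
  · obtain ⟨t, rfl⟩ := h5
    exact ⟨_, _, hG 1 G.one_mem t, h2.append t⟩
  exact ⟨v, 1, G.one_mem, h3 v fun ξ hξ =>
    ⟨fun h' => h4 (h'.prefix_of_le hξ (by omega)), fun h' => h5 (h'.prefix_of_le hξ (by omega))⟩⟩

theorem not_through_of_ne {p r r' : List (Fin d)} {i j : Fin d} (hij : i ≠ j) (ξ : Boundary d)
    (h : Through ξ (p ++ i :: r)) : ¬ Through ξ (p ++ j :: r') := fun h' => by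
  have h1 : Through ξ (p ++ [i] ++ r) := by simpa using h
  have h2 : Through ξ (p ++ [j] ++ r') := by simpa using h'
  have := h1.of_append.eq_of_length_eq h2.of_append (by simp)
  simp [hij] at this

/-- The core of `G` in `AAut_G(T_d)` is trivial. -/
theorem eq_one_of_forall_conj_mem (hd : 2 ≤ d) {G : Subgroup (TreeAut d)} (hG : IsSelfSimilar G)
    (g : AAut G hG) (hg : ∀ x, x⁻¹ * g * x ∈ (toAAut G hG).range) : g = 1 := by
  have : NeZero d := ⟨by omega⟩
  have hg1 := hg 1
  rw [inv_one, one_mul, mul_one] at hg1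
  obtain ⟨s, rfl⟩ := hg1
  suffices hs : s.1 = 1 by
    rw [show s = 1 from Subtype.ext hs, map_one]
  refine Subtype.ext (Equiv.ext fun v => ?_)
  change s.1.1 v = v
  induction v using List.reverseRecOn with
  | nil => exact s.1.map_nil
  | append_singleton p i ih =>
    obtain ⟨j, hj⟩ := s.1.map_concat p i
    rw [ih] at hj
    by_contra hne
    have hij : i ≠ j := fun h => hne (by rw [hj, h])
    -- Suppose `s` fixes `p` and sends `pi` to `pj` with `j ≠ i`. The cones of `pi` and `pji` are
    -- disjoint and have different depths. With `z ≠ i`, and `y` sent to `z` by the section of `s`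
    -- at `pi`, the conjugate `φ⁻¹sφ` moves the cones `pjiy → piy → pjz → pjz`. It thus lowers depth
    -- by one, which no tree automorphism does.
    obtain ⟨φ, hφ, h1, h2, h3⟩ := exists_swapCones hG (u := p ++ [i]) (u' := p ++ [j, i])
      fun ξ => not_through_of_ne hij ξ
    obtain ⟨z, hz⟩ : ∃ z : Fin d, z ≠ i := by
      have : Nontrivial (Fin d) := Fin.nontrivial_iff_two_le.2 hd
      exact exists_ne i
    let σ := treeSection s.1 (p ++ [i])
    obtain ⟨y, hy⟩ : ∃ y, σ.1 [y] = [z] := by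
      obtain ⟨y, hy⟩ := (σ⁻¹).map_concat [] z
      refine ⟨y, ?_⟩
      rw [TreeAut.map_nil] at hy
      have : σ⁻¹.1 [z] = [y] := hy
      rw [← this]; simp
    have h4 : ActsOn φ (p ++ [j, z]) (p ++ [j, z]) 1 := h3 _ fun ξ hξ =>
      ⟨not_through_of_ne hij.symm ξ hξ, by
        have := not_through_of_ne (p := p ++ [j]) (r := []) (r' := []) hz ξ (by simpa using hξ)
        simpa using this⟩
    have h5 := (actsOn_boundaryHom s.1 (p ++ [i])).append [y]
    rw [hj, hy, List.append_assoc p [j]] at h5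
    have h6 := ((h2.append [y]).mul h5).mul h4.inv
    obtain ⟨k, hk⟩ := hg ⟨φ, hφ⟩
    have hk' : boundaryHom d k.1 = φ⁻¹ * (boundaryHom d s.1 * φ) := by
      rw [← mul_assoc]
      exact congrArg Subtype.val hk
    rw [← hk'] at h6
    have h7 := congrArg List.length (h6.unique hd (actsOn_boundaryHom k.1 _)).1
    simp [TreeAut.length_map] at h7

/-! ### Closures of branching subgroups -/

/-- An approximation in `H` of an element that fixes level `M`, good to depth at least `M`, fixes
level `M` itself and so lies in `K`. -/
theorem topologicalClosure_inf_levelStabilizer_le {H K : Subgroup (TreeAut d)} {M : ℕ}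
    (hM : H ⊓ levelStabilizer d M ≤ K) :
    H.topologicalClosure ⊓ levelStabilizer d M ≤ K.topologicalClosure := fun g hg => by
  refine mem_topologicalClosure_iff.2 fun n => ?_
  obtain ⟨h, hh, hhg⟩ := mem_topologicalClosure_iff.1 hg.1 (max M n)
  refine ⟨h, hM ⟨hh, ?_⟩, levelStabilizer_antitone (le_max_right _ _) hhg⟩
  have := levelStabilizer_antitone (le_max_left M n) hhg
  simpa using Subgroup.mul_mem _ hg.2 (Subgroup.inv_mem _ this)

/-- The sections at the letters are approximated separately in `K` and glued. -/
theorem levelOneProduct_topologicalClosure_le {K : Subgroup (TreeAut d)}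
    (hK : levelOneProduct K ≤ K) :
    levelOneProduct K.topologicalClosure ≤ K.topologicalClosure := fun g hg => by
  refine mem_topologicalClosure_iff.2 fun n => ?_
  have := fun x => mem_topologicalClosure_iff.1 (hg x).2 n
  choose k hk hkg using this
  refine ⟨glue k, hK (glue_mem_levelOneProduct hk), inv_mul_mem_levelStabilizer_iff.2 fun v hv => ?_⟩
  cases v with
  | nil => rw [TreeAut.map_nil, TreeAut.map_nil]
  | cons x v =>
    have := inv_mul_mem_levelStabilizer_iff.1 (hkg x) v (by simp at hv; omega)
    rw [glue_cons, ← this, show x :: v = [x] ++ v from rfl, treeSection_spec, (hg x).1]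
    rfl

/-! ### Almost automorphisms of type `H` and of type the closure of `H` -/

theorem AAut_mono {H G : Subgroup (TreeAut d)} (hH : IsSelfSimilar H) (hG : IsSelfSimilar G)
    (h : H ≤ G) : AAut H hH ≤ AAut G hG := fun _ ⟨T, T', ψ, hψ, hl⟩ =>
  ⟨T, T', ψ, hψ, fun v => h (hl v)⟩

/-- A tree automorphism in the closure of `H` that is piecewise of type `H` belongs to `H`. -/
theorem mem_of_boundaryHom_mem_AAut (hd : 2 ≤ d) {H K : Subgroup (TreeAut d)}
    (hH : IsSelfSimilar H) (hKH : K ≤ H) (hK : levelOneProduct K ≤ K) {M : ℕ}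
    (hM : H ⊓ levelStabilizer d M ≤ K) {g : TreeAut d} (hg : g ∈ H.topologicalClosure)
    (hgA : boundaryHom d g ∈ AAut H hH) : g ∈ H := by
  have : NeZero d := ⟨by omega⟩
  obtain ⟨n, hn⟩ := IsPiecewise.uniform hH hgA
  -- At level `n` the sections of `g` lie in `H`, by uniqueness of local actions. With `h` agreeing
  -- with `g` to depth `n + M`, the sections of `h⁻¹g` at level `n` lie in `H` and fix level `M`,
  -- hence lie in `K`.
  obtain ⟨h, hh, hhg⟩ := mem_topologicalClosure_iff.1 hg (n + M)
  suffices h⁻¹ * g ∈ K by simpa using H.mul_mem hh (hKH this)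
  refine mem_of_sections hK n fun v hv => ⟨?_, hM ⟨?_, treeSection_mem_levelStabilizer hhg hv.le⟩⟩
  · exact mem_levelStabilizer_iff.1 hhg v (by omega)
  · obtain ⟨u, s, hs, hus⟩ := hn v hv
    rw [treeSection_mul, ← ((actsOn_boundaryHom g v).unique hd hus).2.symm]
    exact H.mul_mem (hH _ (H.inv_mem hh) _) hs

/-- Every almost automorphism of type the closure of `H` is the product of one of type `H` and an
element of the closure of `H`. -/
theorem exists_mem_AAut_mul {H K : Subgroup (TreeAut d)} (hH : IsSelfSimilar H) (hKH : K ≤ H)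
    (hK : levelOneProduct K ≤ K) {M : ℕ} (hM : H ⊓ levelStabilizer d M ≤ K)
    {φ : Boundary d ≃ₜ Boundary d} (hφ : IsPiecewise H.topologicalClosure φ) :
    ∃ γ ∈ AAut H hH, ∃ κ ∈ H.topologicalClosure, φ = γ * boundaryHom d κ := by
  obtain ⟨n, hn⟩ := hφ.uniform hH.topologicalClosure
  have h1 : ∀ v : List (Fin d), ∃ u, ∃ g h : TreeAut d, v.length = n →
      ActsOn φ v u g ∧ h ∈ H ∧ h⁻¹ * g ∈ K.topologicalClosure := fun v => by
    by_cases hv : v.length = n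
    · obtain ⟨u, g, hg, hu⟩ := hn v hv
      obtain ⟨h, hh, hhg⟩ := mem_topologicalClosure_iff.1 hg M
      exact ⟨u, g, h, fun _ => ⟨hu, hh, topologicalClosure_inf_levelStabilizer_le hM
        ⟨Subgroup.mul_mem _ (Subgroup.inv_mem _ (Subgroup.le_topologicalClosure _ hh)) hg, hhg⟩⟩⟩
    · exact ⟨[], 1, 1, fun h => absurd h hv⟩
  choose u g h hugh using h1
  -- Below `v`, the map `φκ⁻¹` then acts by `g(h⁻¹g)⁻¹ = h`, which is in `H`.
  obtain ⟨κ, hκ, hκv⟩ := exists_sections (levelOneProduct_topologicalClosure_le hK) n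
    (fun v => (h v)⁻¹ * g v) fun v hv => (hugh v hv).2.2
  have hmono : K.topologicalClosure ≤ H.topologicalClosure :=
    closure_mono (s := (K : Set (TreeAut d))) hKH
  refine ⟨φ * (boundaryHom d κ)⁻¹, UniformAt.isPiecewise (n := n) hH fun v hv => ?_, κ, hmono hκ,
    by simp⟩
  refine ⟨u v, h v, (hugh v hv).2.1, ?_⟩
  have h2 := actsOn_boundaryHom κ v
  rw [(hκv v hv).1, (hκv v hv).2] at h2
  simpa using h2.inv.mul (hugh v hv).1

open Pointwise in
/-- A branching group that contains a congruence subgroup is commensurated. -/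
theorem commensurator_range_toAAut [NeZero d] {H K : Subgroup (TreeAut d)} (hH : IsSelfSimilar H)
    (hKH : K ≤ H) (hK : levelOneProduct K ≤ K) {M : ℕ} (hM : H ⊓ levelStabilizer d M ≤ K) :
    Subgroup.Commensurable.commensurator (toAAut H hH).range = ⊤ := by
  have key : ∀ c : ConjAct (AAut H hH),
      (toAAut H hH).range.relIndex (c • (toAAut H hH).range) ≠ 0 := fun c => by
    -- The stabilizer of level `0` is the whole group, so this conjugates a level stabilizer of `H`,
    -- which has finite index in `H`, into `H`.
    obtain ⟨m, hm⟩ := exists_conj_levelStabilizer hH hKH hK hM (ConjAct.ofConjAct c).2 0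
    let S : Subgroup (AAut H hH) := ((levelStabilizer d m).subgroupOf H).map (toAAut H hH)
    have h1 : S.relIndex (toAAut H hH).range ≠ 0 := by
      have : ((levelStabilizer d m).subgroupOf H).FiniteIndex := by
        have := levelStabilizer_finiteIndex d m
        infer_instance
      have h2 : ((levelStabilizer d m).subgroupOf H).relIndex ⊤ ≠ 0 := by
        rw [Subgroup.relIndex_top_right]
        exact this.index_ne_zero
      rw [MonoidHom.range_eq_map, Subgroup.relIndex_map_map]
      exact fun h => h2 (Subgroup.relIndex_eq_zero_of_le_left le_sup_left
        (by rwa [top_sup_eq] at h))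
    have h2 : (c • S).relIndex (c • (toAAut H hH).range) ≠ 0 := by
      rwa [Subgroup.relIndex_pointwise_smul]
    have h3 : c • S ≤ (toAAut H hH).range := by
      rintro _ ⟨_, ⟨g, hg, rfl⟩, rfl⟩
      obtain ⟨k, hk, hgk⟩ := hm g ⟨g.2, hg⟩
      exact ⟨⟨k, hk.1⟩, Subtype.ext hgk.symm⟩
    exact fun h => h2 (Subgroup.relIndex_eq_zero_of_le_left h3 h)
  refine eq_top_iff.2 fun γ _ => ?_
  rw [Subgroup.Commensurable.commensurator_mem_iff]
  refine ⟨?_, key _⟩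
  -- The other half of commensurability is `key` for the inverse, conjugated back by `γ`.
  have := key (ConjAct.toConjAct γ)⁻¹
  rwa [← Subgroup.relIndex_pointwise_smul (ConjAct.toConjAct γ), smul_inv_smul] at this

/-! ### The topology of `AAut_G(T_d)` -/

theorem toAAut_injective [NeZero d] {G : Subgroup (TreeAut d)} (hG : IsSelfSimilar G) :
    Function.Injective (toAAut G hG) := fun _ _ hgh =>
  Subtype.ext (boundaryHom_injective (congrArg Subtype.val hgh))

theorem nhds_one_subgroup_hasBasis (G : Subgroup (TreeAut d)) :
    (𝓝 (1 : G)).HasBasis (fun _ : ℕ => True) fun n =>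
      ((levelStabilizer d n).subgroupOf G : Set G) := by
  rw [nhds_subtype_eq_comap]
  exact (nhds_one_hasBasis_levelStabilizer d).comap _

/-- The images of the level stabilizers of `G` as a basis of neighborhoods of the identity. -/
abbrev levelStabilizerBasis {G : Subgroup (TreeAut d)} (hG : IsSelfSimilar G)
    (h : ∀ γ ∈ AAut G hG, ∀ n, ∃ m, ∀ g ∈ G ⊓ levelStabilizer d m,
      ∃ k ∈ G ⊓ levelStabilizer d n, γ * boundaryHom d g * γ⁻¹ = boundaryHom d k) :
    GroupFilterBasis (AAut G hG) where
  sets := Set.range fun n => toAAut G hG '' ((levelStabilizer d n).subgroupOf G)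
  nonempty := ⟨_, 0, rfl⟩
  inter_sets := by
    rintro _ _ ⟨m, rfl⟩ ⟨n, rfl⟩
    refine ⟨_, ⟨max m n, rfl⟩, Set.subset_inter ?_ ?_⟩
    · exact Set.image_mono fun g hg => levelStabilizer_antitone (le_max_left m n) hg
    · exact Set.image_mono fun g hg => levelStabilizer_antitone (le_max_right m n) hg
  one' := by
    rintro _ ⟨n, rfl⟩
    exact ⟨1, Subgroup.one_mem _, map_one _⟩
  mul' := by
    rintro _ ⟨n, rfl⟩
    refine ⟨_, ⟨n, rfl⟩, ?_⟩
    rintro _ ⟨_, ⟨a, ha, rfl⟩, _, ⟨b, hb, rfl⟩, rfl⟩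
    exact ⟨a * b, Subgroup.mul_mem _ ha hb, map_mul _ _ _⟩
  inv' := by
    rintro _ ⟨n, rfl⟩
    refine ⟨_, ⟨n, rfl⟩, ?_⟩
    rintro _ ⟨a, ha, rfl⟩
    exact ⟨a⁻¹, Subgroup.inv_mem _ ha, map_inv _ _⟩
  conj' := by
    rintro γ _ ⟨n, rfl⟩
    obtain ⟨m, hm⟩ := h γ.1 γ.2 n
    refine ⟨_, ⟨m, rfl⟩, ?_⟩
    rintro _ ⟨a, ha, rfl⟩
    obtain ⟨k, hk, hak⟩ := hm a ⟨a.2, ha⟩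
    exact ⟨⟨k, hk.1⟩, hk.2, Subtype.ext hak.symm⟩

/-- The basis makes the neighborhoods of the identity the images of those in `G`. For a homomorphism
this yields both continuity and openness. Compactness comes from `G` being closed in the compact
group of all tree automorphisms. -/
theorem isCompatibleTopology_levelStabilizerBasis [NeZero d] {G : Subgroup (TreeAut d)}
    (hG : IsSelfSimilar G) (hGc : IsClosed (G : Set (TreeAut d)))
    (h : ∀ γ ∈ AAut G hG, ∀ n, ∃ m, ∀ g ∈ G ⊓ levelStabilizer d m,
      ∃ k ∈ G ⊓ levelStabilizer d n, γ * boundaryHom d g * γ⁻¹ = boundaryHom d k) :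
    IsCompatibleTopology G hG (levelStabilizerBasis hG h).topology := by
  let B := levelStabilizerBasis hG h
  let _ : TopologicalSpace (AAut G hG) := B.topology
  have htop : IsTopologicalGroup (AAut G hG) := B.isTopologicalGroup
  have hnhds : 𝓝 (1 : AAut G hG) = Filter.map (toAAut G hG) (𝓝 1) := by
    refine B.nhds_one_hasBasis.eq_of_same_basis ?_
    refine ((nhds_one_subgroup_hasBasis G).map (toAAut G hG)).to_hasBasis ?_ ?_
    · exact fun n _ => ⟨_, ⟨n, rfl⟩, subset_rfl⟩
    · rintro _ ⟨n, rfl⟩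
      exact ⟨n, trivial, subset_rfl⟩
  have hcont : Continuous (toAAut G hG) := by
    refine continuous_of_continuousAt_one _ ?_
    change Filter.map _ _ ≤ _
    rw [map_one, hnhds]
  have hopen : IsOpenMap (toAAut G hG) := IsTopologicalGroup.isOpenMap_iff_nhds_one.2 hnhds.le
  have : CompactSpace G := isCompact_iff_compactSpace.1 hGc.isCompact
  exact ⟨htop, .of_continuous_injective_isOpenMap hcont (toAAut_injective hG) hopen,
    isCompact_range hcont⟩

/-- The open embedding of `G` prescribes the neighborhood filter of the identity, and this
determines a group topology. -/
theorem IsCompatibleTopology.unique {G : Subgroup (TreeAut d)} {hG : IsSelfSimilar G}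
    {τ τ' : TopologicalSpace (AAut G hG)} (h : IsCompatibleTopology G hG τ)
    (h' : IsCompatibleTopology G hG τ') : τ = τ' := by
  refine IsTopologicalGroup.ext h.1 h'.1 ?_
  have e := @IsOpenEmbedding.map_nhds_eq _ _ _ _ τ h.2.1 1
  have e' := @IsOpenEmbedding.map_nhds_eq _ _ _ _ τ' h'.2.1 1
  rw [map_one] at e e'
  rw [← e, ← e']

/-- In a factorization `φ = γκ` with `γ` of type `H` and `κ` in the closure of `H`, the factor `κ`
is a limit of elements `h` of `H`, so `φ` is a limit of the elements `γh`. -/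
theorem denseRange_inclusion {H K : Subgroup (TreeAut d)} (hH : IsSelfSimilar H) (hKH : K ≤ H)
    (hK : levelOneProduct K ≤ K) {M : ℕ} (hM : H ⊓ levelStabilizer d M ≤ K)
    [TopologicalSpace (AAut H.topologicalClosure hH.topologicalClosure)]
    [IsTopologicalGroup (AAut H.topologicalClosure hH.topologicalClosure)]
    (hc : Continuous (toAAut H.topologicalClosure hH.topologicalClosure)) :
    DenseRange (Subgroup.inclusion
      (AAut_mono hH hH.topologicalClosure H.le_topologicalClosure)) := by
  intro φ
  obtain ⟨γ, hγ, κ, hκ, hφ⟩ := exists_mem_AAut_mul hH hKH hK hM φ.2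
  let j := Subgroup.inclusion (AAut_mono hH hH.topologicalClosure H.le_topologicalClosure)
  let ι := toAAut H.topologicalClosure hH.topologicalClosure
  have h1 : φ = j ⟨γ, hγ⟩ * ι ⟨κ, hκ⟩ := Subtype.ext hφ
  have h2 : (⟨κ, hκ⟩ : H.topologicalClosure) ∈
      closure (Subtype.val ⁻¹' (H : Set (TreeAut d)) : Set H.topologicalClosure) := by
    have h3 : Subtype.val '' (Subtype.val ⁻¹' (H : Set (TreeAut d)) : Set H.topologicalClosure) =
        (H : Set (TreeAut d)) := by
      rw [Set.image_preimage_eq_iff, Subtype.range_coe]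
      exact H.le_topologicalClosure
    rw [closure_subtype, h3]
    exact hκ
  rw [h1]
  refine map_mem_closure (f := fun k => j ⟨γ, hγ⟩ * ι k) (by fun_prop) h2 fun k hk => ?_
  exact ⟨⟨γ, hγ⟩ * toAAut H hH ⟨k.1, hk⟩, rfl⟩

/-- The completion theorem for a self-similar group `H` with a branching subgroup `K` that
contains a level stabilizer of `H`. -/
theorem inclusionInducesIso_of_branching (hd : 2 ≤ d) {H K : Subgroup (TreeAut d)}
    (hH : IsSelfSimilar H) (hKH : K ≤ H) (hK : levelOneProduct K ≤ K) {M : ℕ}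
    (hM : H ⊓ levelStabilizer d M ≤ K) : InclusionInducesIso H hH := by
  have : NeZero d := ⟨by omega⟩
  refine ⟨commensurator_range_toAAut hH hKH hK hM, ?_, fun τ hτ => ?_⟩
  · refine ⟨_, isCompatibleTopology_levelStabilizerBasis hH.topologicalClosure
      H.isClosed_topologicalClosure fun γ hγ n => ?_, fun τ hτ => hτ.unique ?_⟩
    · exact exists_conj_levelStabilizer hH.topologicalClosure
        (closure_mono (s := (K : Set (TreeAut d))) hKH)
        (levelOneProduct_topologicalClosure_le hK) (topologicalClosure_inf_levelStabilizer_le hM)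
        hγ n
    · exact isCompatibleTopology_levelStabilizerBasis _ H.isClosed_topologicalClosure _
  · have htop := hτ.1
    have hopen : IsOpen ((toAAut H.topologicalClosure hH.topologicalClosure).range :
        Set (AAut H.topologicalClosure hH.topologicalClosure)) := by
      rw [MonoidHom.coe_range]
      exact hτ.2.1.isOpen_range
    have hcomp : IsCompact
        ((toAAut H.topologicalClosure hH.topologicalClosure).range :
        Set (AAut H.topologicalClosure hH.topologicalClosure)) := by
      rw [MonoidHom.coe_range]
      exact hτ.2.2
    -- Inside `AAut_G`, the groups `G` and `AAut_H` intersect exactly in `H`.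
    have hΛ : (toAAut H hH).range =
        (toAAut H.topologicalClosure hH.topologicalClosure).range.comap
          (Subgroup.inclusion (AAut_mono hH hH.topologicalClosure H.le_topologicalClosure)) := by
      ext γ
      constructor
      · rintro ⟨h, rfl⟩
        exact ⟨⟨h.1, H.le_topologicalClosure h.2⟩, rfl⟩
      · rintro ⟨g, hg⟩
        have hg' : boundaryHom d g.1 = γ.1 := congrArg Subtype.val hg
        have := mem_of_boundaryHom_mem_AAut hd hH hKH hK hM g.2 (hg' ▸ γ.2)
        exact ⟨⟨g.1, this⟩, Subtype.ext hg'⟩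
    obtain ⟨Φ, hΦ⟩ := exists_schlichting_iso hopen hcomp
      (eq_one_of_forall_conj_mem hd hH.topologicalClosure)
      (denseRange_inclusion hH hKH hK hM hτ.2.1.continuous) hΛ
    exact ⟨Φ, fun γ => congrArg Subtype.val (hΦ γ)⟩

/-! ### Gluing as a homomorphism -/

theorem eq_glue {g : TreeAut d} (h : ∀ x, g.1 [x] = [x]) :
    g = glue fun x => treeSection g [x] := by
  refine Subtype.ext (Equiv.ext fun v => ?_)
  cases v with
  | nil => rw [TreeAut.map_nil, TreeAut.map_nil]
  | cons x w => rw [glue_cons, show x :: w = [x] ++ w from rfl, treeSection_spec, h]; rfl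

/-- Gluing tree automorphisms on the subtrees of level one, as a homomorphism. -/
def glueHom (d : ℕ) : (Fin d → TreeAut d) →* TreeAut d where
  toFun := glue
  map_one' := Subtype.ext (Equiv.ext fun v => by cases v <;> rfl)
  map_mul' _ _ := Subtype.ext (Equiv.ext fun v => by cases v <;> rfl)

theorem glue_mul (k l : Fin d → TreeAut d) : glue k * glue l = glue (k * l) :=
  ((glueHom d).map_mul k l).symm

theorem glue_inv (k : Fin d → TreeAut d) : (glue k)⁻¹ = glue k⁻¹ := ((glueHom d).map_inv k).symm

theorem glue_one : glue (1 : Fin d → TreeAut d) = 1 := (glueHom d).map_one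

theorem glue_zpow (k : Fin d → TreeAut d) (n : ℤ) : glue k ^ n = glue (k ^ n) :=
  ((glueHom d).map_zpow k n).symm

theorem glue_pair_mul (k l k' l' : TreeAut 2) :
    glue ![k, l] * glue ![k', l'] = glue ![k * k', l * l'] := by
  rw [glue_mul]
  congr 1
  ext x : 1
  fin_cases x <;> rfl

theorem glue_pair_inv (k l : TreeAut 2) : (glue ![k, l])⁻¹ = glue ![k⁻¹, l⁻¹] := by
  rw [glue_inv]
  congr 1
  ext x : 1
  fin_cases x <;> rfl

theorem glue_pair_one : glue ![(1 : TreeAut 2), 1] = 1 := by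
  have : (![1, 1] : Fin 2 → TreeAut 2) = 1 := by
    ext x : 1
    fin_cases x <;> rfl
  rw [this, glue_one]

theorem glue_pair_zpow (k l : TreeAut 2) (n : ℤ) : glue ![k, l] ^ n = glue ![k ^ n, l ^ n] := by
  rw [glue_zpow]
  congr 1
  ext x : 1
  fin_cases x <;> rfl

/-! ### Relations in the Grigorchuk group -/

theorem grigorchukA_mul_self : grigorchukA * grigorchukA = 1 :=
  Subtype.ext (Equiv.ext grigA_grigA)

theorem grigorchukB_mul_self (k : Fin 3) : grigorchukB k * grigorchukB k = 1 :=
  Subtype.ext (Equiv.ext (grigB_grigB k))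

/-- The relation is proved for all cyclic shifts at once: below the letter `1` it becomes the next
shift, and below `0` the three generators act by `a`, `a`, `1` in some order. -/
theorem grigB_grigB_grigB (k : Fin 3) (w : List (Fin 2)) :
    grigB k (grigB (k + 1) (grigB (k + 2) w)) = w := by
  induction w generalizing k with
  | nil => simp [grigB]
  | cons x w ih =>
    by_cases hx : x = 0
    · fin_cases k <;> simp [grigB, hx, grigA_grigA]
    · have hx1 : x = 1 := by omega
      have := ih (k + 1)
      rw [show k + 1 + 2 = k + 2 + 1 from add_right_comm k 1 2] at this
      simp [grigB, hx1, this]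

theorem grigorchukB_mul_mul (k : Fin 3) :
    grigorchukB k * (grigorchukB (k + 1) * grigorchukB (k + 2)) = 1 :=
  Subtype.ext (Equiv.ext (grigB_grigB_grigB k))

theorem grigorchukB_one_eq : grigorchukB 1 = grigorchukB 0 * grigorchukB 2 := by
  have h := grigorchukB_mul_mul 0
  have h0 := eq_inv_of_mul_eq_one_right h
  rw [inv_eq_of_mul_eq_one_right (grigorchukB_mul_self 0)] at h0
  simp only [zero_add] at h0
  rw [← h0, mul_assoc, grigorchukB_mul_self, mul_one]

/-- The product `bd = c` of two involutions is an involution. -/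
theorem grigorchukB_commute : grigorchukB 2 * grigorchukB 0 = grigorchukB 0 * grigorchukB 2 := by
  have h := congrArg (·⁻¹) grigorchukB_one_eq
  simp only [mul_inv_rev, inv_eq_of_mul_eq_one_right (grigorchukB_mul_self _)] at h
  rw [← h, grigorchukB_one_eq]

theorem grigorchukB_eq_glue (k : Fin 3) :
    grigorchukB k = glue ![if k = 2 then 1 else grigorchukA, grigorchukB (k + 1)] := by
  refine Subtype.ext (Equiv.ext fun v => ?_)
  cases v with
  | nil => rfl
  | cons x w =>
    change grigB k (x :: w) = _
    rw [glue_cons]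
    by_cases hx : x = 0
    · subst hx
      by_cases hk : k = 2
      · simp [grigB, hk]
      · simp [grigB, hk, grigorchukA, treeAutOfInvolution]
    · have hx1 : x = 1 := by omega
      subst hx1
      simp [grigB, grigorchukB, treeAutOfInvolution]

theorem grigorchukA_mul_glue_mul (k l : TreeAut 2) :
    grigorchukA * glue ![k, l] * grigorchukA = glue ![l, k] := by
  refine Subtype.ext (Equiv.ext fun v => ?_)
  cases v with
  | nil => rfl
  | cons x w =>
    change grigA ((glue ![k, l]).1 (grigA (x :: w))) = _
    fin_cases x <;> simp [grigA]

theorem grigorchukB_zero_eq_glue : grigorchukB 0 = glue ![grigorchukA, grigorchukB 1] := by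
  rw [grigorchukB_eq_glue]; rfl

theorem grigorchukB_one_eq_glue : grigorchukB 1 = glue ![grigorchukA, grigorchukB 2] := by
  rw [grigorchukB_eq_glue]; rfl

theorem grigorchukB_two_eq_glue : grigorchukB 2 = glue ![1, grigorchukB 0] := by
  rw [grigorchukB_eq_glue]; rfl

theorem grigorchukA_mem : grigorchukA ∈ grigorchukGroup := Subgroup.subset_closure (by simp)

theorem grigorchukB_mem (k : Fin 3) : grigorchukB k ∈ grigorchukGroup :=
  Subgroup.subset_closure (by fin_cases k <;> simp)

/-! ### The branching subgroup of the Grigorchuk group -/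

/-- The element `(ab)²`. -/
def grigorchukT : TreeAut 2 := grigorchukA * grigorchukB 0 * grigorchukA * grigorchukB 0

/-- The normal closure of `(ab)²` in the Grigorchuk group. -/
def grigorchukK : Subgroup (TreeAut 2) :=
  Subgroup.closure {x | ∃ γ ∈ grigorchukGroup, x = γ * grigorchukT * γ⁻¹}

theorem grigorchukT_mem : grigorchukT ∈ grigorchukGroup :=
  mul_mem (mul_mem (mul_mem grigorchukA_mem (grigorchukB_mem 0)) grigorchukA_mem)
    (grigorchukB_mem 0)

theorem conj_grigorchukT_mem {γ : TreeAut 2} (hγ : γ ∈ grigorchukGroup) :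
    γ * grigorchukT * γ⁻¹ ∈ grigorchukK := Subgroup.subset_closure ⟨γ, hγ, rfl⟩

theorem grigorchukK_le : grigorchukK ≤ grigorchukGroup := by
  refine (Subgroup.closure_le _).2 ?_
  rintro _ ⟨γ, hγ, rfl⟩
  exact mul_mem (mul_mem hγ grigorchukT_mem) (inv_mem hγ)

theorem conj_mem_grigorchukK {γ k : TreeAut 2} (hγ : γ ∈ grigorchukGroup) (hk : k ∈ grigorchukK) :
    γ * k * γ⁻¹ ∈ grigorchukK := by
  have : grigorchukK ≤ grigorchukK.comap (MulAut.conj γ).toMonoidHom := by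
    refine (Subgroup.closure_le _).2 ?_
    rintro _ ⟨η, hη, rfl⟩
    change γ * (η * grigorchukT * η⁻¹) * γ⁻¹ ∈ grigorchukK
    have := conj_grigorchukT_mem (mul_mem hγ hη)
    simpa [mul_assoc] using this
  exact this hk

/-- Every element of the Grigorchuk group is the section at the letter `0` of an element of the
stabilizer of the first level. -/
theorem exists_glue_mem_grigorchukGroup {γ : TreeAut 2} (hγ : γ ∈ grigorchukGroup) :
    ∃ μ, glue ![γ, μ] ∈ grigorchukGroup := by
  have hconj : ∀ k l, glue ![k, l] ∈ grigorchukGroup → glue ![l, k] ∈ grigorchukGroup :=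
    fun k l h => by
      rw [← grigorchukA_mul_glue_mul]
      exact mul_mem (mul_mem grigorchukA_mem h) grigorchukA_mem
  induction hγ using Subgroup.closure_induction with
  | mem s hs =>
    -- `a` is the left section of `b`; `b`, `c`, `d` are the right sections of `d`, `b`, `c`, moved
    -- to the left by conjugation with `a`.
    rcases hs with rfl | rfl | rfl | rfl
    · exact ⟨_, grigorchukB_zero_eq_glue ▸ grigorchukB_mem 0⟩
    · exact ⟨_, hconj _ _ (grigorchukB_two_eq_glue ▸ grigorchukB_mem 2)⟩
    · exact ⟨_, hconj _ _ (grigorchukB_zero_eq_glue ▸ grigorchukB_mem 0)⟩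
    · exact ⟨_, hconj _ _ (grigorchukB_one_eq_glue ▸ grigorchukB_mem 1)⟩
  | one =>
    refine ⟨1, ?_⟩
    rw [glue_pair_one]
    exact one_mem _
  | mul g h _ _ hg hh =>
    obtain ⟨μ, hμ⟩ := hg
    obtain ⟨ν, hν⟩ := hh
    refine ⟨μ * ν, ?_⟩
    have := mul_mem hμ hν
    rwa [glue_pair_mul] at this
  | inv g _ hg =>
    obtain ⟨μ, hμ⟩ := hg
    refine ⟨μ⁻¹, ?_⟩
    have := inv_mem hμ
    rwa [glue_pair_inv] at this

/-- Write `t = (ab)²`. Since `ada = (b, 1)` and `b = (a, c)`, the square of `adab = (ba, c)` is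
`((ba)², 1) = (t, 1)⁻¹`. As `b` and `d` commute, the same square equals `(ad)t(ad)⁻¹ · t`, a product
of conjugates of `t`. -/
theorem glue_grigorchukT_mem : glue ![grigorchukT, 1] ∈ grigorchukK := by
  have ha : ∀ x, grigorchukA * (grigorchukA * x) = x := fun x => by
    rw [← mul_assoc, grigorchukA_mul_self, one_mul]
  have hb : ∀ k x, grigorchukB k * (grigorchukB k * x) = x := fun k x => by
    rw [← mul_assoc, grigorchukB_mul_self, one_mul]
  have hd : ∀ x, grigorchukB 2 * (grigorchukB 0 * x) = grigorchukB 0 * (grigorchukB 2 * x) :=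
    fun x => by rw [← mul_assoc, grigorchukB_commute, mul_assoc]
  have ha' : grigorchukA⁻¹ = grigorchukA := inv_eq_of_mul_eq_one_right grigorchukA_mul_self
  have hb' : ∀ k, (grigorchukB k)⁻¹ = grigorchukB k := fun k =>
    inv_eq_of_mul_eq_one_right (grigorchukB_mul_self k)
  have h1 : grigorchukA * grigorchukB 2 * grigorchukA = glue ![grigorchukB 0, 1] := by
    nth_rw 1 [grigorchukB_two_eq_glue]
    exact grigorchukA_mul_glue_mul _ _
  have h2 : (glue ![grigorchukT, 1])⁻¹ = grigorchukA * grigorchukB 2 * grigorchukA *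
      grigorchukB 0 * (grigorchukA * grigorchukB 2 * grigorchukA * grigorchukB 0) := by
    rw [h1]
    conv_rhs => rw [show glue ![grigorchukB 0, 1] * grigorchukB 0 =
      glue ![grigorchukB 0, 1] * glue ![grigorchukA, grigorchukB 1] by
        rw [← grigorchukB_zero_eq_glue]]
    rw [glue_pair_mul, glue_pair_mul, glue_pair_inv, one_mul, grigorchukB_mul_self, inv_one]
    simp [grigorchukT, ha', hb', mul_assoc]
  have h3 : (glue ![grigorchukT, 1])⁻¹ =
      (grigorchukA * grigorchukB 2) * grigorchukT * (grigorchukA * grigorchukB 2)⁻¹ *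
        (1 * grigorchukT * 1⁻¹) := by
    rw [h2]
    simp [grigorchukT, mul_assoc, ha', hb', ha, hb, hd]
  rw [← inv_mem_iff, h3]
  exact mul_mem (conj_grigorchukT_mem (mul_mem grigorchukA_mem (grigorchukB_mem 2)))
    (conj_grigorchukT_mem (one_mem _))

/-- Conjugating `(t, 1)` by an element `(γ, μ)` of the group gives `(γtγ⁻¹, 1)`, and every `γ` in
the group occurs as such a left section. -/
theorem glue_mem_grigorchukK {k : TreeAut 2} (hk : k ∈ grigorchukK) :
    glue ![k, 1] ∈ grigorchukK := by
  induction hk using Subgroup.closure_induction with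
  | mem s hs =>
    obtain ⟨γ, hγ, rfl⟩ := hs
    obtain ⟨μ, hμ⟩ := exists_glue_mem_grigorchukGroup hγ
    have := conj_mem_grigorchukK hμ glue_grigorchukT_mem
    rwa [glue_pair_inv, glue_pair_mul, glue_pair_mul, mul_one, mul_inv_cancel] at this
  | one => rw [glue_pair_one]; exact one_mem _
  | mul g h _ _ hg hh =>
    have := mul_mem hg hh
    rwa [glue_pair_mul, mul_one] at this
  | inv g _ hg =>
    have := inv_mem hg
    rwa [glue_pair_inv, inv_one] at this

theorem levelOneProduct_grigorchukK_le : levelOneProduct grigorchukK ≤ grigorchukK := by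
  intro g hg
  -- `(k, l) = (k, 1) · a(l, 1)a⁻¹`, so the left factor alone suffices.
  have h1 : g = glue ![treeSection g [0], 1] *
      (grigorchukA * glue ![treeSection g [1], 1] * grigorchukA⁻¹) := by
    rw [inv_eq_of_mul_eq_one_right grigorchukA_mul_self, grigorchukA_mul_glue_mul, glue_pair_mul,
      mul_one, one_mul]
    conv_lhs => rw [eq_glue fun x => (hg x).1]
    congr 1
    ext x : 1
    fin_cases x <;> rfl
  rw [h1]
  exact mul_mem (glue_mem_grigorchukK (hg 0).2)
    (conj_mem_grigorchukK grigorchukA_mem (glue_mem_grigorchukK (hg 1).2))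

/-! ### Parity of the activity on the levels of the binary tree -/

/-- The number modulo 2 of vertices of level `n` at which `g` exchanges the two children. -/
def levelParity : ℕ → TreeAut 2 → ZMod 2
  | 0, g => if g.1 [0] = [0] then 0 else 1
  | n + 1, g => levelParity n (treeSection g [0]) + levelParity n (treeSection g [1])

theorem apply_letter (g : TreeAut 2) :
    (g.1 [0] = [0] ∧ g.1 [1] = [1]) ∨ (g.1 [0] = [1] ∧ g.1 [1] = [0]) := by
  obtain ⟨y, hy⟩ := g.map_concat [] 0
  obtain ⟨z, hz⟩ := g.map_concat [] 1
  rw [g.map_nil] at hy hz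
  simp only [List.nil_append] at hy hz
  have hne : g.1 [0] ≠ g.1 [1] := fun h => by simpa using g.1.injective h
  rw [hy, hz] at hne ⊢
  revert hne
  fin_cases y <;> fin_cases z <;> simp

/-- The sections of `g` entering the product are those at the images under `h`; a swap by `h` only
reorders the two summands. -/
theorem levelParity_mul (n : ℕ) (g h : TreeAut 2) :
    levelParity n (g * h) = levelParity n g + levelParity n h := by
  induction n generalizing g h with
  | zero =>
    have : (g * h).1 [0] = g.1 (h.1 [0]) := rfl
    unfold levelParity
    rw [this]
    rcases apply_letter g with ⟨h1, h2⟩ | ⟨h1, h2⟩ <;>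
      rcases apply_letter h with ⟨h3, h4⟩ | ⟨h3, h4⟩ <;> simp [h1, h2, h3]
    decide
  | succ n ih =>
    simp only [levelParity, treeSection_mul, ih]
    rcases apply_letter h with ⟨h3, h4⟩ | ⟨h3, h4⟩ <;> rw [h3, h4] <;> ring

/-- The parity of the activity on level `n`, as a homomorphism. -/
def levelParityHom (n : ℕ) : TreeAut 2 →* Multiplicative (ZMod 2) :=
  MonoidHom.mk' (fun g => .ofAdd (levelParity n g)) fun g h => by
    rw [levelParity_mul]; rfl

theorem levelParity_one (n : ℕ) : levelParity n 1 = 0 :=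
  congrArg Multiplicative.toAdd (levelParityHom n).map_one

theorem levelParity_inv (n : ℕ) (g : TreeAut 2) : levelParity n g⁻¹ = - levelParity n g :=
  congrArg Multiplicative.toAdd ((levelParityHom n).map_inv g)

theorem levelParity_zpow (n : ℕ) (g : TreeAut 2) (i : ℤ) :
    levelParity n (g ^ i) = i * levelParity n g := by
  rw [← zsmul_eq_mul]
  exact congrArg Multiplicative.toAdd ((levelParityHom n).map_zpow g i)

theorem levelParity_eq_zero {n : ℕ} {g : TreeAut 2} (hg : g ∈ levelStabilizer 2 (n + 1)) :
    levelParity n g = 0 := by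
  induction n generalizing g with
  | zero => simp [levelParity, hg [0] rfl]
  | succ n ih =>
    rw [Nat.add_comm] at hg
    rw [levelParity, ih (treeSection_mem_levelStabilizer hg le_rfl),
      ih (treeSection_mem_levelStabilizer hg le_rfl), add_zero]

theorem levelParity_zero_eq_zero_iff {g : TreeAut 2} : levelParity 0 g = 0 ↔ g.1 [0] = [0] := by
  simp [levelParity]

theorem levelParity_succ_glue (n : ℕ) (k l : TreeAut 2) :
    levelParity (n + 1) (glue ![k, l]) = levelParity n k + levelParity n l := by
  simp [levelParity]

theorem levelParity_zero_glue (k : Fin 2 → TreeAut 2) : levelParity 0 (glue k) = 0 := by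
  simp [levelParity, TreeAut.map_nil]

/-- The automorphisms of the binary tree with even activity on the levels 0, 1, 2, and with even
activity on the first two levels of the left subtree. -/
def evenActivity : Subgroup (TreeAut 2) where
  carrier := {g | levelParity 0 g = 0 ∧ levelParity 1 g = 0 ∧ levelParity 2 g = 0 ∧
    levelParity 0 (treeSection g [0]) + levelParity 1 (treeSection g [0]) = 0}
  one_mem' := by
    have : treeSection (1 : TreeAut 2) [0] = 1 := treeSection_unique 1 1 [0] fun _ => rfl
    simp [this, levelParity_one]
  mul_mem' := by
    rintro g h ⟨g0, g1, g2, g3⟩ ⟨h0, h1, h2, h3⟩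
    refine ⟨by rw [levelParity_mul, g0, h0, add_zero], by rw [levelParity_mul, g1, h1, add_zero],
      by rw [levelParity_mul, g2, h2, add_zero], ?_⟩
    rw [treeSection_mul, levelParity_zero_eq_zero_iff.1 h0, levelParity_mul, levelParity_mul]
    linear_combination g3 + h3
  inv_mem' := by
    rintro g ⟨g0, g1, g2, g3⟩
    refine ⟨by rw [levelParity_inv, g0, neg_zero], by rw [levelParity_inv, g1, neg_zero],
      by rw [levelParity_inv, g2, neg_zero], ?_⟩
    have : g⁻¹.1 [0] = [0] := by
      change g.1⁻¹ [0] = [0]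
      rw [Equiv.Perm.inv_eq_iff_eq, levelParity_zero_eq_zero_iff.1 g0]
    rw [treeSection_inv, this, levelParity_inv, levelParity_inv]
    linear_combination -g3

/-- Level parities are conjugation invariant. A conjugation may exchange the two subtrees, but even
activity on levels 1 and 2 makes the left and right sums equal modulo 2. -/
theorem conj_mem_evenActivity {g : TreeAut 2} (hg : g ∈ evenActivity) (x : TreeAut 2) :
    x * g * x⁻¹ ∈ evenActivity := by
  obtain ⟨g0, g1, g2, g3⟩ := hg
  have hn : ∀ n, levelParity n (x * g * x⁻¹) = levelParity n g := fun n => by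
    rw [levelParity_mul, levelParity_mul, levelParity_inv]; ring
  refine ⟨by rw [hn, g0], by rw [hn, g1], by rw [hn, g2], ?_⟩
  have hg0 := levelParity_zero_eq_zero_iff.1 g0
  have hg1 : g.1 [1] = [1] := by
    rcases apply_letter g with h | h
    · exact h.2
    · rw [h.1] at hg0; simp at hg0
  have key : ∀ y, g.1 [y] = [y] →
      levelParity 0 (treeSection g [y]) + levelParity 1 (treeSection g [y]) = 0 →
      x⁻¹.1 [0] = [y] → levelParity 0 (treeSection (x * g * x⁻¹) [0]) +
        levelParity 1 (treeSection (x * g * x⁻¹) [0]) = 0 := fun y h1 h2 h3 => by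
    rw [treeSection_mul, treeSection_mul, treeSection_inv, h3, h1]
    simp only [levelParity_mul, levelParity_inv]
    linear_combination h2
  rcases apply_letter x⁻¹ with h | h
  · exact key 0 hg0 g3 h.1
  · refine key 1 hg1 ?_ h.1
    have g1' : levelParity 0 (treeSection g [0]) + levelParity 0 (treeSection g [1]) = 0 := g1
    have g2' : levelParity 1 (treeSection g [0]) + levelParity 1 (treeSection g [1]) = 0 := g2
    linear_combination g1' + g2' - g3

theorem levelParity_grigorchukA_zero : levelParity 0 grigorchukA = 1 := by
  have : grigorchukA.1 [0] = [1] := rfl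
  simp [levelParity, this]

theorem levelParity_grigorchukA_succ (n : ℕ) : levelParity (n + 1) grigorchukA = 0 := by
  have : ∀ x, treeSection grigorchukA [x] = 1 := fun x => treeSection_unique _ _ _ fun w => rfl
  simp [levelParity, this, levelParity_one]

theorem levelParity_zero_grigorchukB (k : Fin 3) : levelParity 0 (grigorchukB k) = 0 := by
  rw [grigorchukB_eq_glue, levelParity_zero_glue]

theorem levelParity_one_grigorchukB_zero : levelParity 1 (grigorchukB 0) = 1 := by
  rw [grigorchukB_zero_eq_glue, levelParity_succ_glue, levelParity_zero_grigorchukB,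
    levelParity_grigorchukA_zero, add_zero]

theorem levelParity_one_grigorchukB_one : levelParity 1 (grigorchukB 1) = 1 := by
  rw [grigorchukB_one_eq_glue, levelParity_succ_glue, levelParity_zero_grigorchukB,
    levelParity_grigorchukA_zero, add_zero]

theorem levelParity_one_grigorchukB_two : levelParity 1 (grigorchukB 2) = 0 := by
  rw [grigorchukB_two_eq_glue, levelParity_succ_glue, levelParity_zero_grigorchukB,
    levelParity_one, add_zero]

theorem levelParity_two_grigorchukB_zero : levelParity 2 (grigorchukB 0) = 1 := by
  rw [grigorchukB_zero_eq_glue, levelParity_succ_glue, levelParity_one_grigorchukB_one,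
    levelParity_grigorchukA_succ, zero_add]

theorem levelParity_two_grigorchukB_two : levelParity 2 (grigorchukB 2) = 1 := by
  rw [grigorchukB_two_eq_glue, levelParity_succ_glue, levelParity_one_grigorchukB_zero,
    levelParity_one, zero_add]

theorem grigorchukT_eq_glue :
    grigorchukT = glue ![grigorchukB 1 * grigorchukA, grigorchukA * grigorchukB 1] := by
  rw [grigorchukT, grigorchukB_zero_eq_glue, grigorchukA_mul_glue_mul, glue_pair_mul]

theorem grigorchukK_le_evenActivity : grigorchukK ≤ evenActivity := by
  refine (Subgroup.closure_le _).2 ?_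
  rintro _ ⟨γ, -, rfl⟩
  refine conj_mem_evenActivity ?_ γ
  -- `t` is a square.
  have h : ∀ n, levelParity n grigorchukT = 0 := fun n => by
    simp only [grigorchukT, levelParity_mul]
    rw [add_assoc, CharTwo.add_self_eq_zero]
  refine ⟨h 0, h 1, h 2, ?_⟩
  rw [grigorchukT_eq_glue, treeSection_glue]
  simp only [Matrix.cons_val_zero, levelParity_mul, levelParity_zero_grigorchukB,
    levelParity_one_grigorchukB_one, levelParity_grigorchukA_zero, levelParity_grigorchukA_succ]
  decide

/-! ### The Grigorchuk group modulo the branching subgroup -/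

/-- `B` is central in the generated subgroup, and the involutions `A` and `D` generate a dihedral
group with rotation `AD`. The set of normal forms is stable under left multiplication by the
generators, since `A` inverts `AD` and `D = A · AD`. -/
theorem exists_normal_form {Q : Type*} [Group Q] {A B D : Q} (hA : A * A = 1) (hB : B * B = 1)
    (hD : D * D = 1) (hAB : Commute A B) (hDB : Commute D B) {q : Q}
    (hq : q ∈ Subgroup.closure {A, B, D}) : ∃ i j k : ℤ, q = B ^ i * (A * D) ^ j * A ^ k := by
  have hA' : A⁻¹ = A := inv_eq_of_mul_eq_one_right hA
  have hB' : B⁻¹ = B := inv_eq_of_mul_eq_one_right hB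
  have hD' : D⁻¹ = D := inv_eq_of_mul_eq_one_right hD
  have hleftB : ∀ i j k : ℤ, B * (B ^ i * (A * D) ^ j * A ^ k) =
      B ^ (1 + i) * (A * D) ^ j * A ^ k := fun i j k => by
    simp only [zpow_add, zpow_one, mul_assoc]
  have hAAD : ∀ j : ℤ, A * (A * D) ^ j = (A * D) ^ (-j) * A := fun j => by
    have h1 : A * (A * D) * A⁻¹ = (A * D)⁻¹ := by
      rw [mul_inv_rev, hA', hD', ← mul_assoc, hA, one_mul]
    have h2 := conj_zpow (a := A) (b := A * D) (i := j)
    rw [h1, inv_zpow, ← zpow_neg] at h2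
    rw [h2]; simp
  have hleftA : ∀ i j k : ℤ, A * (B ^ i * (A * D) ^ j * A ^ k) =
      B ^ i * (A * D) ^ (-j) * A ^ (1 + k) := fun i j k => by
    rw [← mul_assoc, ← mul_assoc, (hAB.zpow_right i).eq, mul_assoc (B ^ i), hAAD, zpow_add,
      zpow_one]
    simp only [mul_assoc]
  have hleftD : ∀ i j k : ℤ, D * (B ^ i * (A * D) ^ j * A ^ k) =
      B ^ i * (A * D) ^ (-(1 + j)) * A ^ (1 + k) := fun i j k => by
    rw [← hleftA, zpow_add, zpow_one]
    have h1 : ∀ x, D * x = A * (A * D * x) := fun x => by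
      rw [mul_assoc A D, ← mul_assoc A A, hA, one_mul]
    have h2 : Commute (A * D) (B ^ i) := (hAB.mul_left hDB).zpow_right i
    rw [h1, ← mul_assoc (B ^ i) (A * D), ← h2.eq]
    simp only [mul_assoc]
  have hleft : ∀ x ∈ ({A, B, D} : Set Q), ∀ y, (∃ i j k : ℤ, y = B ^ i * (A * D) ^ j * A ^ k) →
      ∃ i j k : ℤ, x * y = B ^ i * (A * D) ^ j * A ^ k := by
    rintro x (rfl | rfl | rfl) _ ⟨i, j, k, rfl⟩
    · exact ⟨_, _, _, hleftA i j k⟩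
    · exact ⟨_, _, _, hleftB i j k⟩
    · exact ⟨_, _, _, hleftD i j k⟩
  induction hq using Subgroup.closure_induction_left with
  | one => exact ⟨0, 0, 0, by simp⟩
  | mul_left x hx y _ ih => exact hleft x hx y ih
  | inv_mul_cancel x hx y _ ih =>
    have : x⁻¹ = x := by rcases hx with rfl | rfl | rfl <;> assumption
    rw [this]
    exact hleft x hx y ih

/-- Modulo `K` the relation `(ab)² = 1` makes `a` and `b` commute, `b` already commutes with `d`,
and `c = bd` is redundant. -/
theorem exists_grigorchuk_normal_form {g : TreeAut 2} (hg : g ∈ grigorchukGroup) :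
    ∃ i j k : ℤ, ∃ κ ∈ grigorchukK, g =
      grigorchukB 0 ^ i * (grigorchukA * grigorchukB 2) ^ j * grigorchukA ^ k * κ := by
  let N : Subgroup grigorchukGroup := grigorchukK.subgroupOf grigorchukGroup
  have hN : N.Normal := ⟨fun n hn γ => conj_mem_grigorchukK γ.2 hn⟩
  let q := QuotientGroup.mk' N
  let a : grigorchukGroup := ⟨grigorchukA, grigorchukA_mem⟩
  let b : Fin 3 → grigorchukGroup := fun k => ⟨grigorchukB k, grigorchukB_mem k⟩
  have ha : a * a = 1 := Subtype.ext grigorchukA_mul_self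
  have hb : ∀ k, b k * b k = 1 := fun k => Subtype.ext (grigorchukB_mul_self k)
  have hab : Commute (q a) (q (b 0)) := by
    have h1 : a * b 0 * a * b 0 ∈ N := by
      have := conj_grigorchukT_mem (one_mem grigorchukGroup)
      rw [inv_one, one_mul, mul_one] at this
      exact this
    have h2 : q (a * b 0 * a * b 0) = 1 := (QuotientGroup.eq_one_iff _).2 h1
    have ha' : (q a)⁻¹ = q a := inv_eq_of_mul_eq_one_right (by rw [← map_mul, ha, map_one])
    have hb' : (q (b 0))⁻¹ = q (b 0) :=
      inv_eq_of_mul_eq_one_right (by rw [← map_mul, hb, map_one])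
    rw [map_mul, map_mul, map_mul, mul_assoc] at h2
    have h3 := eq_inv_of_mul_eq_one_left h2
    rwa [mul_inv_rev, ha', hb'] at h3
  have hdb : Commute (q (b 2)) (q (b 0)) := by
    have : Commute (b 2) (b 0) := Subtype.ext grigorchukB_commute
    exact this.map q
  have hgen : ∀ x (hx : x ∈ grigorchukGroup),
      q ⟨x, hx⟩ ∈ Subgroup.closure {q a, q (b 0), q (b 2)} := by
    intro x hx
    induction hx using Subgroup.closure_induction with
    | mem s hs =>
      have h0 : q (b 0) ∈ Subgroup.closure {q a, q (b 0), q (b 2)} :=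
        Subgroup.subset_closure (by simp)
      have h2 : q (b 2) ∈ Subgroup.closure {q a, q (b 0), q (b 2)} :=
        Subgroup.subset_closure (by simp)
      rcases hs with rfl | rfl | rfl | rfl
      · exact Subgroup.subset_closure (Or.inl rfl)
      · exact h0
      · have h1 : b 1 = b 0 * b 2 := Subtype.ext grigorchukB_one_eq
        change q (b 1) ∈ _
        rw [h1, map_mul]
        exact mul_mem h0 h2
      · exact h2
    | one => exact one_mem _
    | mul x y _ _ hx hy => exact mul_mem hx hy
    | inv x _ hx => exact inv_mem hx
  obtain ⟨i, j, k, h⟩ := exists_normal_form (by rw [← map_mul, ha, map_one])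
    (by rw [← map_mul, hb, map_one]) (by rw [← map_mul, hb, map_one]) hab hdb (hgen g hg)
  simp only [← map_mul, ← map_zpow] at h
  have h1 := QuotientGroup.eq.1 h.symm
  exact ⟨i, j, k, (grigorchukB 0 ^ i * (grigorchukA * grigorchukB 2) ^ j * grigorchukA ^ k)⁻¹ * g,
    h1, (mul_inv_cancel_left _ _).symm⟩

theorem grigorchukGroup_inf_levelStabilizer_le :
    grigorchukGroup ⊓ levelStabilizer 2 3 ≤ grigorchukK := by
  rintro g ⟨hg, hg3⟩
  obtain ⟨i, j, k, κ, hκ, rfl⟩ := exists_grigorchuk_normal_form hg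
  obtain ⟨κ0, κ1, κ2, κ3⟩ := grigorchukK_le_evenActivity hκ
  have h0 := levelParity_eq_zero (n := 0) (levelStabilizer_antitone (by norm_num) hg3)
  have h1 := levelParity_eq_zero (n := 1) (levelStabilizer_antitone (by norm_num) hg3)
  have h2 := levelParity_eq_zero (n := 2) (levelStabilizer_antitone (by norm_num) hg3)
  simp only [levelParity_mul, levelParity_zpow, levelParity_zero_grigorchukB,
    levelParity_one_grigorchukB_zero, levelParity_one_grigorchukB_two,
    levelParity_two_grigorchukB_zero, levelParity_two_grigorchukB_two,
    levelParity_grigorchukA_zero, levelParity_grigorchukA_succ, κ0, κ1, κ2, mul_zero, mul_one,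
    add_zero, zero_add] at h0 h1 h2
  -- Modulo 2 the parities on levels 1, 2 and 0 read `i`, `i + j` and `j + k`, so all three
  -- exponents are even.
  have hi : (i : ZMod 2) = 0 := h1
  rw [hi, zero_add] at h2
  rw [h2, zero_add] at h0
  rw [ZMod.intCast_zmod_eq_zero_iff_dvd] at hi h2 h0
  obtain ⟨i, rfl⟩ := hi
  obtain ⟨j, rfl⟩ := h2
  obtain ⟨k, rfl⟩ := h0
  have hb : grigorchukB 0 ^ (2 : ℤ) = 1 := by rw [zpow_two, grigorchukB_mul_self]
  have ha : grigorchukA ^ (2 : ℤ) = 1 := by rw [zpow_two, grigorchukA_mul_self]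
  -- `(ad)² = (ada)d = (b, 1)(1, b)`, so what remains of the normal form is a power of `(b, b)`
  -- times `κ`.
  have had : (grigorchukA * grigorchukB 2) ^ (2 : ℤ) = glue ![grigorchukB 0, grigorchukB 0] := by
    rw [zpow_two, ← mul_assoc]
    nth_rw 1 [grigorchukB_two_eq_glue]
    rw [grigorchukA_mul_glue_mul, grigorchukB_two_eq_glue, glue_pair_mul, mul_one, one_mul]
  simp only [Nat.cast_ofNat, zpow_mul, hb, ha, had, one_zpow, one_mul, mul_one,
    glue_pair_zpow] at hg3 ⊢
  -- The left section `bʲ · κ₀`, with `κ₀` the left section of `κ`, fixes level 2, so its activity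
  -- on levels 0 and 1 is even. In the sum of these parities `κ₀` contributes zero, by the last
  -- condition of `evenActivity`, and `bʲ` contributes `j`. Hence `j` is even and `(b, b)ʲ` is
  -- trivial.
  have hs := treeSection_mem_levelStabilizer (m := 1) (n := 2) hg3 (v := [0]) le_rfl
  have h3 := levelParity_eq_zero (n := 0) (levelStabilizer_antitone (by norm_num) hs)
  have h4 := levelParity_eq_zero (n := 1) hs
  rw [treeSection_mul, levelParity_zero_eq_zero_iff.1 κ0, treeSection_glue, levelParity_mul,
    Matrix.cons_val_zero, levelParity_zpow] at h3 h4
  rw [levelParity_zero_grigorchukB] at h3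
  rw [levelParity_one_grigorchukB_zero] at h4
  have h5 : (j : ZMod 2) = 0 := by linear_combination h3 + h4 - κ3
  rw [ZMod.intCast_zmod_eq_zero_iff_dvd] at h5
  obtain ⟨j, rfl⟩ := h5
  rw [Nat.cast_ofNat, zpow_mul, hb, one_zpow, glue_pair_one, one_mul]
  exact hκ

end TreeAA

open TreeAA

theorem mainTheorem7 :
    (∀ (d : ℕ), 2 ≤ d → ∀ (H K : Subgroup (TreeAut d)) (hH : IsRegularBranchOver H K),
      IsCongruenceSubgroup H K → InclusionInducesIso H hH.selfSimilar) ∧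
    InclusionInducesIso grigorchukGroup grigorchukGroup_isSelfSimilar := by
  refine ⟨fun d hd H K hH hK => ?_, ?_⟩
  · obtain ⟨M, hM⟩ := hK.contains_levelStabilizer
    exact inclusionInducesIso_of_branching hd hH.selfSimilar hH.le hH.product_le hM
  · exact inclusionInducesIso_of_branching le_rfl grigorchukGroup_isSelfSimilar grigorchukK_le
      levelOneProduct_grigorchukK_le grigorchukGroup_inf_levelStabilizer_le
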